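/- **Market.** $N$ firms set prices $p^i\in[\ell_i,h_i]$ with $0\le \ell_i<h_i$; let $\mathcal P=\prod_i[\ell_i,h_i]\subset\mathbb R^N$ and let $\|\cdot\|$ be the Euclidean norm. Firm $i$ has mean demand $\lambda^i(\mathbf p)$, twice continuously differentiable on an open neighbourhood of $\mathcal P$, and revenue $r^i(\mathbf p)=p^i\lambda^i(\mathbf p)$. The demand observed in period $t$ is $D^i_t=\lambda^i(\mathbf p_t)+\varepsilon^i_t$, where the random vectors $\varepsilon_t=(\varepsilon^1_t,\dots,\varepsilon^N_t)$ are independent and identically distributed over $t$, and every $\varepsilon^i_t$ has mean $0$ and variance $\sigma^2$. **Assumption 1.** On $\mathcal P$, for all $i$ and all $j\ne i$: $\partial_i\lambda^i<0$, $\partial_j\lambda^i>0$, and $\partial_i^2 r^i\le 0$. **Equilibria.** A generalized Nash equilibrium (GNE) is a $\mathbf p\in\mathcal P$ with $\lambda^i(\mathbf p)\ge 0$ for all $i$, such that for every $i$ the price $p^i$ maximizes $r^i(\cdot,p^{-i})$ over the prices in $[\ell_i,h_i]$ at which $\lambda^i(\cdot,p^{-i})\ge0$. Given coefficients $\alpha^i,\beta^{ij}$,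 the *linear game* is the one in which $\lambda^i$ is replaced by $\alpha^i-\beta^{ii}p^i+\sum_{j\ne i}\beta^{ij}p^j$. The *KKT system* of a game consists of the KKT conditions of all firms' revenue maximization problems (in the own price, with the constraints demand $\ge0$ and $\ell_i\le p^i\le h_i$) taken together. **Assumption 2.** For $\mathbf p\in\mathcal P$ put $\breve\beta^{ii}=-\partial_i\lambda^i(\mathbf p)$, $\breve\beta^{ij}=\partial_j\lambda^i(\mathbf p)$ for $j\neq i$, and $\breve\alpha^i=\lambda^i(\mathbf p)-\sum_j\partial_j\lambda^i(\mathbf p)p^j$. For every $\mathbf p\in\mathcal P$ the KKT system of the linear game with these coefficients has exactly one solution, denoted $\mathbf z(\mathbf p)$ (the noiseless best response), and it satisfies $\ell_i<z^i(\mathbf p)<h_i$ for all $i$. The map $\mathbf z$ is differentiable on $\mathcal P$, and its Jacobian has Euclidean operator norm at most $\gamma$ on $\mathcal P$ for some constant $\gamma<1$. **Algorithm DDEP.** Let $I_0\ge1$ and $v>1$ be real, $I_n=\lfloor I_0v^n\rfloor$, $\delta_n=I_n^{-1/4}$, and let $\hat{\mathbf p}_0\in\mathcal P$. Stage $n=0,1,2,\dots$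 consists of $N+1$ intervals of $I_n$ periods each. In the first interval the prices are $\hat{\mathbf p}_n$; in interval $i+1$, firm $i$ charges $\hat p^i_n+\delta_n$ and all other firms keep their prices. Each firm $i$ then fits $\alpha^i-\beta^{ii}p^i+\sum_{j\ne i}\beta^{ij}p^j$ to its demands observed in this stage by least squares. The next prices $\hat{\mathbf p}_{n+1}$ are a solution of the KKT system of the linear game with the fitted coefficients; if that system has no solution, $\hat{\mathbf p}_{n+1}$ is an arbitrary point of $\mathcal P$. (All $\hat{\mathbf p}_n$ are random vectors.) **Theorem.** Under these assumptions there is exactly one GNE $\mathbf p^*$, it is also the only solution of the KKT system of the true game, and $\hat{\mathbf p}_n\to\mathbf p^*$ in probability as $n\to\infty$. If moreover $v$ is chosen such that $\frac{1+\gamma^2}{2}\sqrt v<1$, then there is a constant $K_5>0$, independent of $n$ and of the run of the algorithm, such that for all $n\ge 0$ $$\mathbb E\,\|\hat{\mathbf p}_{n+1}-\mathbf p^*\|^2\le N^2K_5\,I_n^{-1/2}.$$ -/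

import Mathlib

open MeasureTheory ProbabilityTheory Filter Topology

/-- Vectors of prices of `N` firms, with the Euclidean norm. -/
abbrev Price (N : ℕ) := EuclideanSpace ℝ (Fin N)

/-- The partial derivative of `f` at `p` in the `j`-th coordinate. -/
noncomputable def partialD {N : ℕ} (j : Fin N) (f : Price N → ℝ) (p : Price N) : ℝ :=
  fderiv ℝ f p (EuclideanSpace.single j 1)

/-- An oligopoly of `N` firms: firm `i` chooses its price in `[lo i, hi i]`, and `demand i p` is
its mean demand when the vector of all prices is `p`. -/
structure Market (N : ℕ) where
  lo : Fin N → ℝ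
  hi : Fin N → ℝ
  demand : Fin N → Price N → ℝ

/-- The coefficients of one affine demand function for each firm, namely
`q ↦ α i - β i i * q i + ∑ j ≠ i, β i j * q j` for firm `i`. -/
structure LinearCoeffs (N : ℕ) where
  α : Fin N → ℝ
  β : Fin N → Fin N → ℝ

/-- The affine demand of firm `i` with intercept `a` and sensitivities `b`: the own price enters
with a minus sign, the prices of the competitors with a plus sign. -/
noncomputable def affineDemand {N : ℕ} (i : Fin N) (a : ℝ) (b : Fin N → ℝ) (q : Price N) : ℝ :=
  a - b i * q i + ∑ j ∈ Finset.univ.erase i, b j * q j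

/-- The affine demand of firm `i` with the coefficients `c`. -/
noncomputable def LinearCoeffs.demand {N : ℕ} (c : LinearCoeffs N) (i : Fin N) (q : Price N) : ℝ :=
  affineDemand i (c.α i) (c.β i) q

namespace Market

variable {N : ℕ} (M : Market N)

/-- The set of price vectors that all firms may choose. -/
def box : Set (Price N) := {p | ∀ i, M.lo i ≤ p i ∧ p i ≤ M.hi i}

/-- The expected revenue of firm `i` per period. -/
noncomputable def revenue (i : Fin N) (p : Price N) : ℝ := p i * M.demand i p

/-- Standing conventions of the model: price intervals are nondegenerate and prices are
nonnegative; mean demand is twice continuously differentiable around the set of prices. -/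
structure Regular : Prop where
  lo_nonneg : ∀ i, 0 ≤ M.lo i
  lo_lt_hi : ∀ i, M.lo i < M.hi i
  smooth : ∃ U : Set (Price N), IsOpen U ∧ M.box ⊆ U ∧ ∀ i, ContDiffOn ℝ 2 (M.demand i) U

/-- Demand decreases in the own price and increases in the price of every competitor, and
revenue is concave in the own price. -/
structure DemandAssumption : Prop where
  own_neg : ∀ p ∈ M.box, ∀ i, partialD i (M.demand i) p < 0
  cross_pos : ∀ p ∈ M.box, ∀ i j, j ≠ i → 0 < partialD j (M.demand i) p
  revenue_concave : ∀ p ∈ M.box, ∀ i, partialD i (partialD i (M.revenue i)) p ≤ 0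

/-- The generalized Nash equilibria of the clairvoyant game: `p` is feasible, and no firm `i` can
raise its revenue by moving to another price in `[lo i, hi i]` at which its demand is
nonnegative, while the other prices stay the same. -/
def IsGNE (p : Price N) : Prop :=
  p ∈ M.box ∧ (∀ i, 0 ≤ M.demand i p) ∧
    ∀ i, ∀ q : Price N, (∀ j, j ≠ i → q j = p j) → M.lo i ≤ q i → q i ≤ M.hi i →
      0 ≤ M.demand i q → M.revenue i q ≤ M.revenue i p

/-- The concatenated KKT systems of the firms, when firm `i` maximizes `q i * d i q` over `q i`
subject to `d i q ≥ 0` and `lo i ≤ q i ≤ hi i`, and `s i` is the derivative of `d i` in the own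
price `q i`. -/
def IsKKT (d s : Fin N → Price N → ℝ) (q : Price N) : Prop :=
  ∀ i, ∃ μ₁ μ₂ μ₃ : ℝ,
    d i q + q i * s i q + μ₁ * s i q - μ₂ + μ₃ = 0 ∧
    (0 ≤ μ₁ ∧ μ₁ * d i q = 0 ∧ 0 ≤ d i q) ∧
    (0 ≤ μ₂ ∧ μ₂ * (M.hi i - q i) = 0 ∧ 0 ≤ M.hi i - q i) ∧
    (0 ≤ μ₃ ∧ μ₃ * (q i - M.lo i) = 0 ∧ 0 ≤ q i - M.lo i)

/-- The KKT system of the clairvoyant game. -/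
def IsClairvoyantKKT (q : Price N) : Prop :=
  M.IsKKT M.demand (fun i => partialD i (M.demand i)) q

/-- The KKT system of the game in which demand is affine with the coefficients `c`. -/
def IsLinearKKT (c : LinearCoeffs N) (q : Price N) : Prop :=
  M.IsKKT c.demand (fun i _ => -c.β i i) q

/-- The coefficients without estimation error at `p`: those of the first-order Taylor expansion
of mean demand at `p`. -/
noncomputable def tangentCoeffs (p : Price N) : LinearCoeffs N where
  α i := M.demand i p - ∑ j, partialD j (M.demand i) p * p j
  β i j := if j = i then -partialD i (M.demand i) p else partialD j (M.demand i) p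

/-- The noiseless best responses `z(p)` of all firms: the solution of the KKT system of the game
with the coefficients without estimation error at `p` (meaningful where there is exactly one). -/
noncomputable def response (p : Price N) : Price N :=
  Classical.epsilon fun q => M.IsLinearKKT (M.tangentCoeffs p) q

/-- The operator `z` is well defined on the set of prices, with values off the limits of the
price intervals, and it is differentiable with a Jacobian of Euclidean operator norm at most `γ`. -/
structure ResponseAssumption (γ : ℝ) : Prop where
  existsUnique : ∀ p ∈ M.box, ∃! q, M.IsLinearKKT (M.tangentCoeffs p) q
  interior : ∀ p ∈ M.box, ∀ i, M.lo i < M.response p i ∧ M.response p i < M.hi i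
  differentiable : DifferentiableOn ℝ M.response M.box
  jacobian_le : ∀ p ∈ M.box, ‖fderivWithin ℝ M.response M.box p‖ ≤ γ

end Market

/-- The number of periods `I_n` in each of the `N + 1` intervals of stage `n`. -/
noncomputable def batch (I₀ v : ℝ) (n : ℕ) : ℕ := ⌊I₀ * v ^ n⌋₊

/-- The price shift `δ_n` of stage `n`. -/
noncomputable def shift (I₀ v : ℝ) (n : ℕ) : ℝ := (batch I₀ v n : ℝ) ^ (-(1 / 4) : ℝ)

/-- The last period `t_n` before stage `n` (stage `n` consists of the periods
`t_n + 1, …, t_n + (N + 1) I_n`). -/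
noncomputable def stageStart (N : ℕ) (I₀ v : ℝ) (n : ℕ) : ℕ :=
  ∑ k ∈ Finset.range n, (N + 1) * batch I₀ v k

/-- The prices in period `t_n + 1 + s` of stage `n`, `s < (N + 1) I_n`, when the stage starts
with the prices `p`. The period lies in interval number `s / I_n ∈ {0, …, N}`. In interval `0` the
prices are `p`, and in interval `i + 1` firm `i ∈ {0, …, N - 1}` adds `δ_n` to its price. -/
noncomputable def stagePrice {N : ℕ} (I₀ v : ℝ) (n : ℕ) (p : Price N) (s : ℕ) : Price N :=
  WithLp.toLp 2 fun i => p i + if s / batch I₀ v n = (i : ℕ) + 1 then shift I₀ v n else 0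

/-- The demand of firm `i` observed in period `t_n + 1 + s`, with demand shocks `e t i`. -/
noncomputable def Market.stageDemand {N : ℕ} (M : Market N) (I₀ v : ℝ) (e : ℕ → Fin N → ℝ)
    (n : ℕ) (p : Price N) (s : ℕ) (i : Fin N) : ℝ :=
  M.demand i (stagePrice I₀ v n p s) + e (stageStart N I₀ v n + 1 + s) i

/-- The sum of squared residuals of firm `i` over stage `n`, for intercept `a` and
sensitivities `b`. -/
noncomputable def Market.stageResidual {N : ℕ} (M : Market N) (I₀ v : ℝ) (e : ℕ → Fin N → ℝ)
    (n : ℕ) (p : Price N) (i : Fin N) (a : ℝ) (b : Fin N → ℝ) : ℝ :=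
  ∑ s ∈ Finset.range ((N + 1) * batch I₀ v n),
    (M.stageDemand I₀ v e n p s i - affineDemand i a b (stagePrice I₀ v n p s)) ^ 2

/-- `phat` is a sequence of stage-wise prices produced by the DDEP algorithm with parameters
`I₀`, `v` under the demand shocks `ε`, and `chat (n + 1)` are the estimates computed from the data
of stage `n`. If the KKT system of the estimated game has a solution, the new prices are a
solution; if the estimates are so poor that it has none, they are any admissible prices. -/
structure IsDDEP {N : ℕ} {Ω : Type*} [MeasurableSpace Ω] (M : Market N) (I₀ v : ℝ)
    (ε : ℕ → Ω → Fin N → ℝ) (phat : ℕ → Ω → Price N) (chat : ℕ → Ω → LinearCoeffs N) : Prop where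
  measurable : ∀ n, Measurable (phat n)
  mem_box : ∀ n ω, phat n ω ∈ M.box
  leastSquares : ∀ n ω i a b,
    M.stageResidual I₀ v (fun t => ε t ω) n (phat n ω) i ((chat (n + 1) ω).α i)
        ((chat (n + 1) ω).β i) ≤
      M.stageResidual I₀ v (fun t => ε t ω) n (phat n ω) i a b
  equilibrium : ∀ n ω, (∃ q, M.IsLinearKKT (chat (n + 1) ω) q) →
    M.IsLinearKKT (chat (n + 1) ω) (phat (n + 1) ω)

/-!
The best-response map `z = M.response` has a Jacobian of norm at most `γ < 1` on the convex set of
prices and maps this set into itself, so it has exactly one fixed point. At a price vector `p`, the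
KKT system of the true game agrees with that of the game with the tangent coefficients at `p`
(`Market.isClairvoyantKKT_iff_tangent`); hence the solutions of the true KKT system are the fixed
points of `z`. Once the multipliers are eliminated (`Market.isKKT_iff`), concavity of the revenues
shows that they are also the generalized Nash equilibria.

One stage of the algorithm replaces `p` by `z p` up to an error. The least squares fit has as many
parameters as design points, so it interpolates the averaged demands
(`Market.demand_groupPrice_of_leastSquares`), and its coefficients differ from the tangent ones by
`O(δ + A / δ)`, where `δ` is the shift and `A` the total size of the averaged noise. The solutions
of the linear KKT system depend on the coefficients in a Lipschitz way
(`Market.exists_norm_sub_response_le`): compactness of the set of prices and uniqueness at the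
tangent coefficients show that all solutions for nearby coefficients lie off the bounds, where the
KKT system is a nonsingular linear system. For large errors of the coefficients, the estimate holds
because the prices stay bounded.

Thus `‖phat (n + 1) - pstar‖ ≤ γ * ‖phat n - pstar‖ + C * (δ + A / δ)` in every run, and the last
term involves the noise of stage `n` only, with second moment `O(I ^ (-1/2))` for batches of size
`I` (`integral_shift_add_noise_sq_le`). Young's inequality turns this into a recursion for the mean
squared error with factor `(1 + γ ^ 2) / 2 < 1` (`exists_integral_norm_sq_le`). The mean squared
error therefore tends to zero, and it does so at the rate `v ^ (-n/2)` of the error terms if this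
rate is slower than the contraction.
-/

/-! ### Affine demand functions -/

/-- The derivative of the affine demand of firm `i` in the price of firm `j`, that is, the
sensitivity `β i j` with the sign with which it enters the demand. -/
noncomputable def LinearCoeffs.slope {N : ℕ} (c : LinearCoeffs N) (i j : Fin N) : ℝ :=
  if j = i then -c.β i j else c.β i j

lemma affineDemand_eq {N : ℕ} (i : Fin N) (a : ℝ) (b : Fin N → ℝ) (q : Price N) :
    affineDemand i a b q = a + ∑ j, (if j = i then -b j else b j) * q j := by
  rw [affineDemand, ← Finset.add_sum_erase _ _ (Finset.mem_univ i), if_pos rfl]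
  have : ∑ j ∈ Finset.univ.erase i, (if j = i then -b j else b j) * q j
      = ∑ j ∈ Finset.univ.erase i, b j * q j :=
    Finset.sum_congr rfl fun j hj => by rw [if_neg (Finset.ne_of_mem_erase hj)]
  rw [this]; ring

lemma LinearCoeffs.demand_eq {N : ℕ} (c : LinearCoeffs N) (i : Fin N) (q : Price N) :
    c.demand i q = c.α i + ∑ j, c.slope i j * q j :=
  affineDemand_eq _ _ _ _

lemma LinearCoeffs.demand_eq_add {N : ℕ} (c : LinearCoeffs N) (i : Fin N) (p q : Price N) :
    c.demand i q = c.demand i p + ∑ j, c.slope i j * (q j - p j) := by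
  simp only [LinearCoeffs.demand_eq, mul_sub, Finset.sum_sub_distrib]; ring

namespace Market

variable {N : ℕ} {M : Market N}

lemma slope_tangentCoeffs (p : Price N) (i j : Fin N) :
    (M.tangentCoeffs p).slope i j = partialD j (M.demand i) p := by
  unfold LinearCoeffs.slope tangentCoeffs
  by_cases h : j = i
  · subst h; simp
  · simp [h]

lemma demand_tangentCoeffs (p q : Price N) (i : Fin N) :
    (M.tangentCoeffs p).demand i q =
      M.demand i p + ∑ j, partialD j (M.demand i) p * (q j - p j) := by
  simp only [LinearCoeffs.demand_eq, slope_tangentCoeffs, mul_sub, Finset.sum_sub_distrib]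
  simp only [tangentCoeffs]; ring

lemma demand_tangentCoeffs_self (p : Price N) (i : Fin N) :
    (M.tangentCoeffs p).demand i p = M.demand i p := by
  simp [demand_tangentCoeffs]

/-! ### The KKT systems without multipliers -/

/-- The multipliers can be eliminated from the KKT system: what remains are the signs of the
marginal revenues. The constraint `d i q ≥ 0` never has a multiplier that matters, because a
firm with zero demand and a positive price gains from lowering its price. -/
lemma isKKT_iff (hreg : M.Regular) {d s : Fin N → Price N → ℝ} {q : Price N}
    (hs : ∀ i, s i q < 0) :
    M.IsKKT d s q ↔ ∀ i, (M.lo i ≤ q i ∧ q i ≤ M.hi i) ∧ 0 ≤ d i q ∧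
      (M.lo i < q i → 0 ≤ d i q + s i q * q i) ∧ (q i < M.hi i → d i q + s i q * q i ≤ 0) := by
  refine forall_congr' fun i => ?_
  have hl := hreg.lo_nonneg i
  have hlh := hreg.lo_lt_hi i
  have hsi := hs i
  constructor
  · rintro ⟨μ₁, μ₂, μ₃, h, ⟨h1, h1', hd⟩, ⟨h2, h2', hh⟩, ⟨h3, h3', hl'⟩⟩
    refine ⟨⟨by linarith, by linarith⟩, hd, fun hlq => ?_, fun hqh => ?_⟩
    · have : μ₃ = 0 := by
        rcases mul_eq_zero.1 h3' with h | h <;> linarith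
      nlinarith
    · have h20 : μ₂ = 0 := by
        rcases mul_eq_zero.1 h2' with h | h <;> linarith
      rcases mul_eq_zero.1 h1' with h10 | h10
      · rw [h10, h20] at h; nlinarith
      · rw [h10]; nlinarith
  · rintro ⟨⟨hlq, hqh⟩, hd, hL, hH⟩
    rcases hlq.lt_or_eq with h | h
    · refine ⟨0, d i q + s i q * q i, 0, by ring, by simpa using hd, ⟨hL h, ?_, by linarith⟩,
        ⟨le_rfl, by simp, by linarith⟩⟩
      rcases hqh.lt_or_eq with h' | h'
      · rw [le_antisymm (hH h') (hL h), zero_mul]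
      · rw [h', sub_self, mul_zero]
    · refine ⟨0, 0, -(d i q + s i q * q i), by ring, by simpa using hd,
        ⟨le_rfl, by simp, by linarith⟩, ⟨?_, ?_, by linarith⟩⟩
      · linarith [hH (by linarith)]
      · rw [h, sub_self, mul_zero]

lemma slope_self (c : LinearCoeffs N) (i : Fin N) : c.slope i i = -c.β i i := if_pos rfl

lemma isLinearKKT_iff (hreg : M.Regular) {c : LinearCoeffs N} {q : Price N}
    (hs : ∀ i, c.slope i i < 0) :
    M.IsLinearKKT c q ↔ ∀ i, (M.lo i ≤ q i ∧ q i ≤ M.hi i) ∧ 0 ≤ c.demand i q ∧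
      (M.lo i < q i → 0 ≤ c.demand i q + c.slope i i * q i) ∧
      (q i < M.hi i → c.demand i q + c.slope i i * q i ≤ 0) := by
  simp only [slope_self] at hs ⊢
  exact isKKT_iff (d := c.demand) (s := fun i _ => -c.β i i) hreg hs

/-- A price vector off the bounds solves the linear KKT system as soon as all marginal revenues
vanish: demand is then positive. -/
lemma isLinearKKT_of_interior (hreg : M.Regular) {c : LinearCoeffs N} {q : Price N}
    (hs : ∀ i, c.slope i i < 0) (hq : ∀ i, M.lo i < q i ∧ q i < M.hi i)
    (h : ∀ i, c.demand i q + c.slope i i * q i = 0) : M.IsLinearKKT c q := by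
  refine (isLinearKKT_iff hreg hs).2 fun i => ⟨⟨(hq i).1.le, (hq i).2.le⟩, ?_,
    fun _ => (h i).ge, fun _ => (h i).le⟩
  nlinarith [h i, hs i, (hq i).1, hreg.lo_nonneg i]

lemma isKKT_mem_box {d s : Fin N → Price N → ℝ} {q : Price N} (h : M.IsKKT d s q) :
    q ∈ M.box := fun i => by
  obtain ⟨_, _, _, -, -, ⟨-, -, h2⟩, ⟨-, -, h3⟩⟩ := h i
  exact ⟨by linarith, by linarith⟩

/-- At a price vector `p`, the true game and the game with the tangent coefficients at `p` have
the same demands and the same own-price derivatives. -/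
lemma isClairvoyantKKT_iff_tangent (p : Price N) :
    M.IsClairvoyantKKT p ↔ M.IsLinearKKT (M.tangentCoeffs p) p := by
  unfold IsClairvoyantKKT IsLinearKKT IsKKT
  refine forall_congr' fun i => ?_
  rw [demand_tangentCoeffs_self]
  simp only [tangentCoeffs, if_pos, neg_neg]

/-! ### The set of prices -/

lemma box_eq_preimage : M.box = (EuclideanSpace.equiv (Fin N) ℝ) ⁻¹' Set.Icc M.lo M.hi := by
  ext p
  simp [box, Set.mem_Icc, Pi.le_def, forall_and]

lemma isCompact_box : IsCompact M.box := by
  rw [box_eq_preimage]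
  exact (EuclideanSpace.equiv (Fin N) ℝ).toHomeomorph.isCompact_preimage.2 isCompact_Icc

lemma convex_box : Convex ℝ M.box := by
  rw [box_eq_preimage]
  exact (convex_Icc M.lo M.hi).linear_preimage (EuclideanSpace.equiv (Fin N) ℝ).toLinearMap

lemma box_nonempty (hreg : M.Regular) : M.box.Nonempty :=
  ⟨WithLp.toLp 2 M.lo, fun i => ⟨le_rfl, (hreg.lo_lt_hi i).le⟩⟩

/-! ### Best responses and their fixed point -/

section Response

variable {γ : ℝ}

lemma response_spec (hz : M.ResponseAssumption γ) {p : Price N} (hp : p ∈ M.box) :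
    M.IsLinearKKT (M.tangentCoeffs p) (M.response p) :=
  Classical.epsilon_spec (p := fun q => M.IsLinearKKT (M.tangentCoeffs p) q)
    (hz.existsUnique p hp).exists

lemma eq_response (hz : M.ResponseAssumption γ) {p q : Price N} (hp : p ∈ M.box)
    (h : M.IsLinearKKT (M.tangentCoeffs p) q) : q = M.response p :=
  (hz.existsUnique p hp).unique h (response_spec hz hp)

lemma response_mem_box (hz : M.ResponseAssumption γ) {p : Price N} (hp : p ∈ M.box) :
    M.response p ∈ M.box :=
  isKKT_mem_box (response_spec hz hp)

lemma norm_response_sub_le (hz : M.ResponseAssumption γ) {p q : Price N} (hp : p ∈ M.box)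
    (hq : q ∈ M.box) : ‖M.response p - M.response q‖ ≤ γ * ‖p - q‖ :=
  convex_box.norm_image_sub_le_of_norm_fderivWithin_le hz.differentiable hz.jacobian_le hq hp

lemma ResponseAssumption.nonneg (hreg : M.Regular) (hz : M.ResponseAssumption γ) : 0 ≤ γ := by
  obtain ⟨p, hp⟩ := box_nonempty hreg
  exact (norm_nonneg _).trans (hz.jacobian_le p hp)

lemma exists_response_eq (hreg : M.Regular) (hz : M.ResponseAssumption γ) (hγ : γ < 1) :
    ∃ p ∈ M.box, M.response p = p := by
  obtain ⟨p₀, hp₀⟩ := box_nonempty hreg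
  have hmaps : Set.MapsTo M.response M.box M.box := fun p hp => response_mem_box hz hp
  have hγ0 := hz.nonneg hreg
  have hc : ContractingWith ⟨γ, hγ0⟩ (hmaps.restrict M.response M.box M.box) := by
    refine ⟨by exact_mod_cast hγ, LipschitzWith.of_dist_le_mul fun p q => ?_⟩
    simp only [Subtype.dist_eq, dist_eq_norm]
    exact norm_response_sub_le hz p.2 q.2
  obtain ⟨p, hp, hfix, -⟩ := hc.exists_fixedPoint' isCompact_box.isClosed.isComplete hmaps hp₀
    (edist_ne_top _ _)
  exact ⟨p, hp, hfix⟩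

lemma isClairvoyantKKT_iff_response (hz : M.ResponseAssumption γ) (p : Price N) :
    M.IsClairvoyantKKT p ↔ p ∈ M.box ∧ M.response p = p := by
  rw [isClairvoyantKKT_iff_tangent]
  refine ⟨fun h => ?_, fun ⟨hp, h⟩ => ?_⟩
  · have hp := isKKT_mem_box h
    exact ⟨hp, (eq_response hz hp h).symm⟩
  · have := response_spec hz hp
    rwa [h] at this

lemma response_fixed_unique (hz : M.ResponseAssumption γ) (hγ : γ < 1) {p q : Price N}
    (hp : p ∈ M.box) (hq : q ∈ M.box) (hp' : M.response p = p) (hq' : M.response q = q) :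
    p = q := by
  have := norm_response_sub_le hz hp hq
  rw [hp', hq'] at this
  have h0 : ‖p - q‖ = 0 := by nlinarith [norm_nonneg (p - q)]
  exact sub_eq_zero.1 (norm_eq_zero.1 h0)

end Response

/-! ### Revenue in the own price, and generalized Nash equilibria -/

/-- The price vector `p` with the price of firm `i` replaced by `t`. -/
noncomputable def line (p : Price N) (i : Fin N) (t : ℝ) : Price N :=
  p + (t - p i) • EuclideanSpace.single i 1

lemma line_apply (p : Price N) (i : Fin N) (t : ℝ) (j : Fin N) :
    line p i t j = if j = i then t else p j := by
  by_cases h : j = i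
  · subst h; simp [line]
  · simp [line, h]

lemma line_self (p : Price N) (i : Fin N) : line p i (p i) = p := by simp [line]

lemma line_mem_box {p : Price N} (hp : p ∈ M.box) (i : Fin N) {t : ℝ}
    (ht : t ∈ Set.Icc (M.lo i) (M.hi i)) : line p i t ∈ M.box := by
  intro j
  rw [line_apply]
  split_ifs with h
  · subst h; exact ht
  · exact hp j

lemma hasDerivAt_line (p : Price N) (i : Fin N) (t : ℝ) :
    HasDerivAt (line p i) (EuclideanSpace.single i 1) t := by
  have h := (((hasDerivAt_id t).sub_const (p i)).smul_const
    (EuclideanSpace.single i (1 : ℝ))).const_add p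
  rwa [one_smul] at h

lemma hasDerivAt_comp_line {f : Price N → ℝ} {p : Price N} {i : Fin N} {t : ℝ}
    (hf : DifferentiableAt ℝ f (line p i t)) :
    HasDerivAt (fun t => f (line p i t)) (partialD i f (line p i t)) t :=
  hf.hasFDerivAt.comp_hasDerivAt t (hasDerivAt_line p i t)

lemma Regular.contDiffAt_demand (hreg : M.Regular) {p : Price N} (hp : p ∈ M.box) (i : Fin N) :
    ContDiffAt ℝ 2 (M.demand i) p := by
  obtain ⟨U, hU, hbU, h⟩ := hreg.smooth
  exact (h i).contDiffAt (hU.mem_nhds (hbU hp))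

lemma contDiffAt_partialD {f : Price N → ℝ} {p : Price N} (hf : ContDiffAt ℝ 2 f p)
    (j : Fin N) : ContDiffAt ℝ 1 (partialD j f) p :=
  (hf.fderiv_right (m := 1) (by norm_num)).clm_apply contDiffAt_const

lemma Regular.contDiffAt_revenue (hreg : M.Regular) {p : Price N} (hp : p ∈ M.box) (i : Fin N) :
    ContDiffAt ℝ 2 (M.revenue i) p := by
  have h : ContDiffAt ℝ 2 (fun p : Price N => p i) p :=
    (EuclideanSpace.proj (𝕜 := ℝ) i : Price N →L[ℝ] ℝ).contDiff.contDiffAt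
  exact h.mul (hreg.contDiffAt_demand hp i)

lemma partialD_revenue (hreg : M.Regular) {p : Price N} (hp : p ∈ M.box) (i : Fin N) :
    partialD i (M.revenue i) p = M.demand i p + partialD i (M.demand i) p * p i := by
  have h1 : HasFDerivAt (fun p : Price N => p i)
      (EuclideanSpace.proj (𝕜 := ℝ) i : Price N →L[ℝ] ℝ) p :=
    (EuclideanSpace.proj (𝕜 := ℝ) i : Price N →L[ℝ] ℝ).hasFDerivAt
  have h2 := ((hreg.contDiffAt_demand hp i).differentiableAt (by norm_num)).hasFDerivAt
  have h3 : HasFDerivAt (M.revenue i) _ p := h1.mul h2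
  rw [partialD, h3.fderiv]
  simp [partialD]; ring

lemma continuousOn_partialD (hreg : M.Regular) (i j : Fin N) :
    ContinuousOn (partialD j (M.demand i)) M.box := fun _ hp =>
  (contDiffAt_partialD (hreg.contDiffAt_demand hp i) j).continuousAt.continuousWithinAt

lemma continuousOn_demand (hreg : M.Regular) (i : Fin N) :
    ContinuousOn (M.demand i) M.box := fun _ hp =>
  (hreg.contDiffAt_demand hp i).continuousAt.continuousWithinAt

end Market

lemma HasDerivAt.nonneg_of_eventually_left {r : ℝ → ℝ} {G x : ℝ} (h : HasDerivAt r G x)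
    (hr : ∀ᶠ t in 𝓝[<] x, r t ≤ r x) : 0 ≤ G := by
  refine ge_of_tendsto (h.tendsto_slope.mono_left (nhdsLT_le_nhdsNE x)) ?_
  filter_upwards [hr, self_mem_nhdsWithin] with t ht htx
  rw [slope_def_field]
  exact div_nonneg_of_nonpos (by linarith) (by linarith [Set.mem_Iio.1 htx])

lemma HasDerivAt.nonpos_of_eventually_right {r : ℝ → ℝ} {G x : ℝ} (h : HasDerivAt r G x)
    (hr : ∀ᶠ t in 𝓝[>] x, r t ≤ r x) : G ≤ 0 := by
  refine le_of_tendsto (h.tendsto_slope.mono_left (nhdsGT_le_nhdsNE x)) ?_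
  filter_upwards [hr, self_mem_nhdsWithin] with t ht htx
  rw [slope_def_field]
  exact div_nonpos_of_nonpos_of_nonneg (by linarith) (by linarith [Set.mem_Ioi.1 htx])

namespace Market

variable {N : ℕ} {M : Market N}

lemma isClairvoyantKKT_iff (hreg : M.Regular) (hdem : M.DemandAssumption) {p : Price N}
    (hp : p ∈ M.box) :
    M.IsClairvoyantKKT p ↔ ∀ i, 0 ≤ M.demand i p ∧
      (M.lo i < p i → 0 ≤ partialD i (M.revenue i) p) ∧
      (p i < M.hi i → partialD i (M.revenue i) p ≤ 0) := by
  rw [IsClairvoyantKKT, isKKT_iff hreg (fun i => hdem.own_neg p hp i)]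
  refine forall_congr' fun i => ?_
  rw [partialD_revenue hreg hp]
  exact ⟨fun h => h.2, fun h => ⟨hp i, h⟩⟩

/-- No firm gains by a small price change at an equilibrium. A lower price is always admissible,
since it raises the demand; a slightly higher one is admissible unless the demand is zero, and in
that case the marginal revenue is `p i` times the own-price derivative, which is nonpositive. -/
lemma IsGNE.isClairvoyantKKT (hreg : M.Regular) (hdem : M.DemandAssumption) {p : Price N}
    (h : M.IsGNE p) : M.IsClairvoyantKKT p := by
  obtain ⟨hp, hd, hmax⟩ := h
  refine (isClairvoyantKKT_iff hreg hdem hp).2 fun i => ⟨hd i, fun hl => ?_, fun hh => ?_⟩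
  all_goals
    have hder : HasDerivAt (fun t => M.revenue i (line p i t)) (partialD i (M.revenue i) p) (p i) := by
      have := hasDerivAt_comp_line (f := M.revenue i) (p := p) (i := i) (t := p i)
        (by rw [line_self]; exact (hreg.contDiffAt_revenue hp i).differentiableAt (by norm_num))
      rwa [line_self] at this
    have hle : ∀ t ∈ Set.Icc (M.lo i) (M.hi i), 0 ≤ M.demand i (line p i t) →
        M.revenue i (line p i t) ≤ M.revenue i (line p i (p i)) := by
      intro t ht h0
      rw [line_self]
      refine hmax i _ (fun j hj => by rw [line_apply, if_neg hj]) ?_ ?_ h0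
      · rw [line_apply, if_pos rfl]; exact ht.1
      · rw [line_apply, if_pos rfl]; exact ht.2
  · refine hder.nonneg_of_eventually_left ?_
    have hanti : AntitoneOn (fun t => M.demand i (line p i t)) (Set.Icc (M.lo i) (M.hi i)) := by
      have hdiff : ∀ t ∈ Set.Icc (M.lo i) (M.hi i), HasDerivAt (fun t => M.demand i (line p i t))
          (partialD i (M.demand i) (line p i t)) t := fun t ht => hasDerivAt_comp_line
        ((hreg.contDiffAt_demand (line_mem_box hp i ht) i).differentiableAt (by norm_num))
      refine antitoneOn_of_deriv_nonpos (convex_Icc _ _)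
        (fun t ht => (hdiff t ht).continuousAt.continuousWithinAt)
        (fun t ht => (hdiff t (interior_subset ht)).differentiableAt.differentiableWithinAt) ?_
      intro t ht
      rw [(hdiff t (interior_subset ht)).deriv]
      exact (hdem.own_neg _ (line_mem_box hp i (interior_subset ht)) i).le
    filter_upwards [Ioo_mem_nhdsLT hl] with t ht
    have htI : t ∈ Set.Icc (M.lo i) (M.hi i) := ⟨ht.1.le, ht.2.le.trans (hp i).2⟩
    refine hle t htI ((hd i).trans ?_)
    have := hanti htI (hp i) ht.2.le
    simpa only [line_self] using this
  · rcases (hd i).lt_or_eq with hpos | h0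
    · refine hder.nonpos_of_eventually_right ?_
      have hcont : ContinuousAt (fun t => M.demand i (line p i t)) (p i) := by
        refine (hasDerivAt_comp_line ?_).continuousAt
        rw [line_self]
        exact (hreg.contDiffAt_demand hp i).differentiableAt (by norm_num)
      have hev : ∀ᶠ t in 𝓝 (p i), 0 < M.demand i (line p i t) :=
        hcont.eventually (lt_mem_nhds (by simpa only [line_self] using hpos))
      filter_upwards [Ioo_mem_nhdsGT hh, hev.filter_mono nhdsWithin_le_nhds] with t ht ht'
      exact hle t ⟨(hp i).1.trans ht.1.le, ht.2.le⟩ ht'.le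
    · rw [partialD_revenue hreg hp, ← h0]
      nlinarith [hdem.own_neg p hp i, (hp i).1, hreg.lo_nonneg i]

/-- Since the revenue is concave in the own price, the signs of the marginal revenue at `p` show
that moving away from `p i` in either direction lowers the revenue. -/
lemma IsClairvoyantKKT.isGNE (hreg : M.Regular) (hdem : M.DemandAssumption) {p : Price N}
    (h : M.IsClairvoyantKKT p) : M.IsGNE p := by
  have hp : p ∈ M.box := isKKT_mem_box h
  rw [isClairvoyantKKT_iff hreg hdem hp] at h
  refine ⟨hp, fun i => (h i).1, fun i q hq hql hqh _ => ?_⟩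
  have hqline : q = line p i (q i) := by
    ext j
    rw [line_apply]
    split_ifs with hj
    · rw [hj]
    · exact hq j hj
  have hdiff : ∀ t ∈ Set.Icc (M.lo i) (M.hi i), HasDerivAt (fun t => M.revenue i (line p i t))
      (partialD i (M.revenue i) (line p i t)) t := fun t ht => hasDerivAt_comp_line
    ((hreg.contDiffAt_revenue (line_mem_box hp i ht) i).differentiableAt (by norm_num))
  have hdiff2 : ∀ t ∈ Set.Icc (M.lo i) (M.hi i),
      HasDerivAt (fun t => partialD i (M.revenue i) (line p i t))
      (partialD i (partialD i (M.revenue i)) (line p i t)) t := fun t ht => hasDerivAt_comp_line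
    ((contDiffAt_partialD (hreg.contDiffAt_revenue (line_mem_box hp i ht) i) i).differentiableAt
      (by norm_num))
  have hanti : AntitoneOn (fun t => partialD i (M.revenue i) (line p i t))
      (Set.Icc (M.lo i) (M.hi i)) := by
    refine antitoneOn_of_deriv_nonpos (convex_Icc _ _)
      (fun t ht => (hdiff2 t ht).continuousAt.continuousWithinAt)
      (fun t ht => (hdiff2 t (interior_subset ht)).differentiableAt.differentiableWithinAt) ?_
    intro t ht
    rw [(hdiff2 t (interior_subset ht)).deriv]
    exact hdem.revenue_concave _ (line_mem_box hp i (interior_subset ht)) i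
  have key : M.revenue i (line p i (q i)) ≤ M.revenue i (line p i (p i)) := by
    rcases lt_trichotomy (q i) (p i) with hlt | heq | hgt
    · have hsub : Set.Icc (M.lo i) (p i) ⊆ Set.Icc (M.lo i) (M.hi i) :=
        Set.Icc_subset_Icc_right (hp i).2
      have hmono : MonotoneOn (fun t => M.revenue i (line p i t)) (Set.Icc (M.lo i) (p i)) := by
        refine monotoneOn_of_deriv_nonneg (convex_Icc _ _)
          (fun t ht => (hdiff t (hsub ht)).continuousAt.continuousWithinAt)
          (fun t ht => (hdiff t
            (hsub (interior_subset ht))).differentiableAt.differentiableWithinAt) ?_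
        intro t ht
        have ht' := interior_subset ht
        rw [(hdiff t (hsub ht')).deriv]
        refine ((h i).2.1 (hql.trans_lt hlt)).trans ?_
        simpa only [line_self] using hanti (hsub ht') (hp i) ht'.2
      exact hmono ⟨hql, hlt.le⟩ ⟨(hp i).1, le_rfl⟩ hlt.le
    · rw [heq]
    · have hsub : Set.Icc (p i) (M.hi i) ⊆ Set.Icc (M.lo i) (M.hi i) :=
        Set.Icc_subset_Icc_left (hp i).1
      have hmono : AntitoneOn (fun t => M.revenue i (line p i t)) (Set.Icc (p i) (M.hi i)) := by
        refine antitoneOn_of_deriv_nonpos (convex_Icc _ _)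
          (fun t ht => (hdiff t (hsub ht)).continuousAt.continuousWithinAt)
          (fun t ht => (hdiff t
            (hsub (interior_subset ht))).differentiableAt.differentiableWithinAt) ?_
        intro t ht
        have ht' := interior_subset ht
        rw [(hdiff t (hsub ht')).deriv]
        refine le_trans ?_ ((h i).2.2 (hgt.trans_le hqh))
        simpa only [line_self] using hanti (hp i) (hsub ht') ht'.1
      exact hmono ⟨le_rfl, (hp i).2⟩ ⟨hgt.le, hqh⟩ hgt.le
  rwa [line_self, ← hqline] at key

lemma isGNE_iff_isClairvoyantKKT (hreg : M.Regular) (hdem : M.DemandAssumption) (p : Price N) :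
    M.IsGNE p ↔ M.IsClairvoyantKKT p :=
  ⟨fun h => h.isClairvoyantKKT hreg hdem, fun h => h.isGNE hreg hdem⟩

end Market

/-! ### Stability of the best responses under estimation errors -/

/-- The derivative of the revenue of firm `i` in its own price when the demand has the
coefficients `c`. -/
noncomputable def LinearCoeffs.marginal {N : ℕ} (c : LinearCoeffs N) (i : Fin N)
    (q : Price N) : ℝ :=
  c.demand i q + c.slope i i * q i

/-- The linear part of the affine map which sends prices to the marginal revenues of all firms. -/
noncomputable def LinearCoeffs.marginalLin {N : ℕ} (c : LinearCoeffs N) :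
    Price N →ₗ[ℝ] (Fin N → ℝ) where
  toFun x i := ∑ j, c.slope i j * x j + c.slope i i * x i
  map_add' x y := by
    ext i
    simp only [PiLp.add_apply, Pi.add_apply, mul_add, Finset.sum_add_distrib]; ring
  map_smul' t x := by
    ext i
    simp only [PiLp.smul_apply, Pi.smul_apply, smul_eq_mul, RingHom.id_apply, mul_add,
      Finset.mul_sum]
    congr 1
    · exact Finset.sum_congr rfl fun j _ => by ring
    · ring

lemma LinearCoeffs.marginal_eq_add {N : ℕ} (c : LinearCoeffs N) (i : Fin N) (p q : Price N) :
    c.marginal i q = c.marginal i p + c.marginalLin (q - p) i := by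
  simp only [marginal, marginalLin, LinearMap.coe_mk, AddHom.coe_mk, PiLp.sub_apply]
  rw [c.demand_eq_add i p q]; ring

lemma Finite.exists_pos_forall_le {ι : Type*} [Finite ι] {P : ι → ℝ → Prop}
    (hP : ∀ i a b, a ≤ b → P i b → P i a) (h : ∀ i, ∃ a > 0, P i a) : ∃ a > 0, ∀ i, P i a := by
  choose f hf hPf using h
  cases isEmpty_or_nonempty ι
  · exact ⟨1, one_pos, fun i => isEmptyElim i⟩
  · obtain ⟨i, hi⟩ := Finite.exists_min f
    exact ⟨f i, hf i, fun j => hP j _ _ (hi j) (hPf j)⟩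

lemma EuclideanSpace.abs_apply_le_norm {N : ℕ} (p : Price N) (j : Fin N) : |p j| ≤ ‖p‖ := by
  simpa using PiLp.norm_apply_le p j

namespace Market

variable {N : ℕ} {M : Market N} {γ : ℝ}

/-- The coefficients `c` agree with the tangent coefficients at `p` up to `η`: the values of the
demands at `p` and all their partial derivatives do. -/
structure Close (M : Market N) (p : Price N) (c : LinearCoeffs N) (η : ℝ) : Prop where
  value : ∀ i, |c.demand i p - M.demand i p| ≤ η
  slope : ∀ i j, |c.slope i j - partialD j (M.demand i) p| ≤ η

lemma Close.mono {p : Price N} {c : LinearCoeffs N} {η η' : ℝ} (h : M.Close p c η) (hη : η ≤ η') :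
    M.Close p c η' :=
  ⟨fun i => (h.value i).trans hη, fun i j => (h.slope i j).trans hη⟩

lemma isLinearKKT_iff_marginal (hreg : M.Regular) {c : LinearCoeffs N} {q : Price N}
    (hs : ∀ i, c.slope i i < 0) :
    M.IsLinearKKT c q ↔ ∀ i, (M.lo i ≤ q i ∧ q i ≤ M.hi i) ∧ 0 ≤ c.demand i q ∧
      (M.lo i < q i → 0 ≤ c.marginal i q) ∧ (q i < M.hi i → c.marginal i q ≤ 0) :=
  isLinearKKT_iff hreg hs

lemma marginal_eq_zero (hreg : M.Regular) {c : LinearCoeffs N} {q : Price N}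
    (hs : ∀ i, c.slope i i < 0) (hq : ∀ i, M.lo i < q i ∧ q i < M.hi i)
    (h : M.IsLinearKKT c q) (i : Fin N) : c.marginal i q = 0 :=
  have h' := ((isLinearKKT_iff_marginal hreg hs).1 h i).2.2
  le_antisymm (h'.2 (hq i).2) (h'.1 (hq i).1)

lemma slope_tangentCoeffs_neg (hdem : M.DemandAssumption) {p : Price N} (hp : p ∈ M.box)
    (i : Fin N) : (M.tangentCoeffs p).slope i i < 0 := by
  rw [slope_tangentCoeffs]; exact hdem.own_neg p hp i

lemma exists_bound_box (M : Market N) : ∃ D > 0, ∀ p ∈ M.box, ‖p‖ ≤ D := by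
  obtain ⟨D, hD⟩ := (isCompact_box (M := M)).isBounded.exists_norm_le
  exact ⟨max D 1, by positivity, fun p hp => (hD p hp).trans (le_max_left _ _)⟩

lemma exists_own_slope_le (hreg : M.Regular) (hdem : M.DemandAssumption) :
    ∃ b > 0, ∀ i, ∀ p ∈ M.box, partialD i (M.demand i) p ≤ -b := by
  refine Finite.exists_pos_forall_le (fun i a b hab h p hp => (h p hp).trans (by linarith))
    fun i => ?_
  obtain ⟨b, hb, h⟩ := isCompact_box.exists_forall_le' (a := 0) (continuousOn_partialD hreg i i).neg
    fun p hp => by simpa using hdem.own_neg p hp i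
  exact ⟨b, hb, fun p hp => by linarith [show b ≤ -partialD i (M.demand i) p from h p hp]⟩

lemma exists_response_gap (hz : M.ResponseAssumption γ) :
    ∃ ρ > 0, ∀ i, ∀ p ∈ M.box, M.lo i + ρ ≤ M.response p i ∧ M.response p i ≤ M.hi i - ρ := by
  refine Finite.exists_pos_forall_le (fun i a b hab h p hp =>
    ⟨by linarith [(h p hp).1], by linarith [(h p hp).2]⟩) fun i => ?_
  have hc : ContinuousOn (fun p => M.response p i) M.box :=
    (EuclideanSpace.proj (𝕜 := ℝ) i : Price N →L[ℝ] ℝ).continuous.comp_continuousOn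
      hz.differentiable.continuousOn
  obtain ⟨a, ha, h⟩ := isCompact_box.exists_forall_le' (a := 0)
    (hc.sub (continuousOn_const (c := M.lo i))) fun p hp => sub_pos.2 (hz.interior p hp i).1
  obtain ⟨b, hb, h'⟩ := isCompact_box.exists_forall_le' (a := 0)
    ((continuousOn_const (c := M.hi i)).sub hc) fun p hp => sub_pos.2 (hz.interior p hp i).2
  refine ⟨min a b, lt_min ha hb, fun p hp => ?_⟩
  have h1 : a ≤ M.response p i - M.lo i := h p hp
  have h2 : b ≤ M.hi i - M.response p i := h' p hp
  exact ⟨by linarith [min_le_left a b], by linarith [min_le_right a b]⟩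

/-- The linear system for the interior solutions is nonsingular: if `x` were in the kernel, then
`response p + t • x` would be a second solution of the KKT system for small `t ≠ 0`. -/
lemma marginalLin_injective (hreg : M.Regular) (hdem : M.DemandAssumption)
    (hz : M.ResponseAssumption γ) {p x : Price N} (hp : p ∈ M.box)
    (hx : (M.tangentCoeffs p).marginalLin x = 0) : x = 0 := by
  have hs := slope_tangentCoeffs_neg hdem hp
  have hev : ∀ᶠ t : ℝ in 𝓝 0, ∀ i, M.lo i < (M.response p + t • x) i ∧
      (M.response p + t • x) i < M.hi i := by
    refine eventually_all.2 fun i => ?_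
    have hc : Continuous fun t : ℝ => M.response p i + t * x i := by fun_prop
    have h0 := hc.tendsto 0
    simp only [zero_mul, add_zero] at h0
    filter_upwards [h0.eventually (lt_mem_nhds (hz.interior p hp i).1),
      h0.eventually (gt_mem_nhds (hz.interior p hp i).2)] with t h1 h2
    simpa using And.intro h1 h2
  obtain ⟨t, ht, ht0⟩ :=
    ((hev.filter_mono nhdsWithin_le_nhds).and (self_mem_nhdsWithin (a := (0 : ℝ)) (s := {0}ᶜ))).exists
  have hKKT : M.IsLinearKKT (M.tangentCoeffs p) (M.response p + t • x) := by
    refine isLinearKKT_of_interior hreg hs ht fun i => ?_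
    have h1 := (M.tangentCoeffs p).marginal_eq_add i (M.response p) (M.response p + t • x)
    rw [add_sub_cancel_left, map_smul, hx, smul_zero, Pi.zero_apply, add_zero,
      marginal_eq_zero hreg hs (hz.interior p hp) (response_spec hz hp)] at h1
    exact h1
  have := eq_response hz hp hKKT
  rw [add_eq_left, smul_eq_zero] at this
  exact this.resolve_left ht0

lemma exists_norm_le_marginalLin (hreg : M.Regular) (hdem : M.DemandAssumption)
    (hz : M.ResponseAssumption γ) : ∃ C > 0, ∀ p ∈ M.box, ∀ x : Price N,
      ‖x‖ ≤ C * ∑ i, |(M.tangentCoeffs p).marginalLin x i| := by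
  have hcont : ContinuousOn
      (fun y : Price N × Price N => ∑ i, |(M.tangentCoeffs y.1).marginalLin y.2 i|)
      (M.box ×ˢ Metric.sphere 0 1) := by
    simp only [LinearCoeffs.marginalLin, LinearMap.coe_mk, AddHom.coe_mk, slope_tangentCoeffs]
    have h1 : ∀ i j, ContinuousOn (fun y : Price N × Price N =>
        partialD j (M.demand i) y.1 * y.2 j) (M.box ×ˢ Metric.sphere 0 1) := fun i j =>
      ((continuousOn_partialD hreg i j).comp continuousOn_fst fun y hy => hy.1).mul
        (by fun_prop)
    exact continuousOn_finsetSum _ fun i _ =>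
      ((continuousOn_finsetSum _ fun j _ => h1 i j).add (h1 i i)).abs
  obtain ⟨m, hm, h⟩ := (isCompact_box.prod (isCompact_sphere 0 1)).exists_forall_le' (a := 0)
    hcont (by
      rintro ⟨p, x⟩ ⟨hp, hx⟩
      refine (Finset.sum_nonneg fun i _ => abs_nonneg _).lt_of_ne fun h0 => ?_
      have hx0 : x = 0 := marginalLin_injective hreg hdem hz hp <| by
        ext i
        exact abs_eq_zero.1 ((Finset.sum_eq_zero_iff_of_nonneg fun i _ => abs_nonneg _).1 h0.symm i
          (Finset.mem_univ i))
      rw [hx0] at hx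
      simp at hx)
  refine ⟨m⁻¹, inv_pos.2 hm, fun p hp x => ?_⟩
  rcases eq_or_ne x 0 with rfl | hx
  · simp
  have hxn : 0 < ‖x‖ := norm_pos_iff.2 hx
  have h1 : m ≤ ∑ i, |(M.tangentCoeffs p).marginalLin (‖x‖⁻¹ • x) i| :=
    h (p, ‖x‖⁻¹ • x) ⟨hp, by simp [norm_smul, hxn.ne']⟩
  simp only [map_smul, Pi.smul_apply, smul_eq_mul, abs_mul, ← Finset.mul_sum] at h1
  rw [abs_of_pos (inv_pos.2 hxn)] at h1
  rw [inv_mul_eq_div, le_div_iff₀ hm]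
  rw [inv_mul_eq_div, le_div_iff₀ hxn] at h1
  linarith

/-- Coefficients close to the tangent ones yield nearly the same marginal revenues. -/
lemma exists_marginal_sub_le (M : Market N) : ∃ R > 0, ∀ p ∈ M.box, ∀ q ∈ M.box, ∀ c η,
    M.Close p c η → ∀ i, |c.marginal i q - (M.tangentCoeffs p).marginal i q| ≤ R * η := by
  obtain ⟨D, hD, hbox⟩ := M.exists_bound_box
  refine ⟨1 + N * (2 * D) + D, by positivity, fun p hp q hq c η hc i => ?_⟩
  have hη : 0 ≤ η := (abs_nonneg _).trans (hc.value i)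
  have hqp : ∀ j, |q j - p j| ≤ 2 * D := fun j => by
    have := abs_sub (q j) (p j)
    linarith [EuclideanSpace.abs_apply_le_norm q j, EuclideanSpace.abs_apply_le_norm p j,
      hbox p hp, hbox q hq]
  have e : c.marginal i q - (M.tangentCoeffs p).marginal i q
      = (c.demand i p - M.demand i p)
        + ∑ j, (c.slope i j - partialD j (M.demand i) p) * (q j - p j)
        + (c.slope i i - partialD i (M.demand i) p) * q i := by
    simp only [LinearCoeffs.marginal, slope_tangentCoeffs, demand_tangentCoeffs, sub_mul,
      Finset.sum_sub_distrib]
    rw [c.demand_eq_add i p q]; ring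
  have h2 : |∑ j, (c.slope i j - partialD j (M.demand i) p) * (q j - p j)| ≤ N * (η * (2 * D)) := by
    refine (Finset.abs_sum_le_sum_abs _ _).trans ?_
    have : ∑ j : Fin N, |(c.slope i j - partialD j (M.demand i) p) * (q j - p j)|
        ≤ ∑ _j : Fin N, η * (2 * D) := Finset.sum_le_sum fun j _ => by
      rw [abs_mul]
      exact mul_le_mul (hc.slope i j) (hqp j) (abs_nonneg _) hη
    simpa using this
  have h3 : |(c.slope i i - partialD i (M.demand i) p) * q i| ≤ η * D := by
    rw [abs_mul]
    exact mul_le_mul (hc.slope i i) ((EuclideanSpace.abs_apply_le_norm q i).trans (hbox q hq))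
      (abs_nonneg _) hη
  rw [e]
  refine (abs_add_le _ _).trans ((add_le_add_left (abs_add_le _ _) _).trans ?_)
  nlinarith [hc.value i]

/-- By compactness of the set of prices, the solutions of the KKT systems with coefficients close
to the tangent ones at `p` are uniformly close to the only solution at `p`. This uses that the
KKT conditions without multipliers are closed under limits. -/
lemma exists_close_response (hreg : M.Regular) (hdem : M.DemandAssumption)
    (hz : M.ResponseAssumption γ) {ρ : ℝ} (hρ : 0 < ρ) : ∃ η > 0, ∀ p ∈ M.box, ∀ c q,
      M.Close p c η → M.IsLinearKKT c q → ‖q - M.response p‖ < ρ := by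
  by_contra! hcon
  obtain ⟨b, hb, hslope⟩ := exists_own_slope_le hreg hdem
  obtain ⟨R, hR, hRle⟩ := M.exists_marginal_sub_le
  have hη : ∀ k : ℕ, 0 < b / 2 / ((k : ℝ) + 1) := fun k => by positivity
  choose p hp c q hclose hKKT hfar using fun k => hcon _ (hη k)
  have hqbox : ∀ k, q k ∈ M.box := fun k => isKKT_mem_box (hKKT k)
  have hle : ∀ k : ℕ, b / 2 / ((k : ℝ) + 1) ≤ b / 2 := fun k =>
    div_le_self (by positivity) (by linarith [(Nat.cast_nonneg k : (0 : ℝ) ≤ k)])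
  have hs : ∀ k i, (c k).slope i i < 0 := fun k i => by
    linarith [(abs_le.1 ((hclose k).slope i i)).2, hslope i _ (hp k), hle k]
  obtain ⟨⟨p', q'⟩, ⟨hp', hq'⟩, φ, hφ, hlim⟩ :=
    (isCompact_box.prod isCompact_box).tendsto_subseq (fun k => ⟨hp k, hqbox k⟩ :
      ∀ k, (p k, q k) ∈ M.box ×ˢ M.box)
  have hlim1 : Tendsto (fun k => p (φ k)) atTop (𝓝 p') :=
    (continuous_fst.tendsto (p', q')).comp hlim
  have hlim2 : Tendsto (fun k => q (φ k)) atTop (𝓝 q') :=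
    (continuous_snd.tendsto (p', q')).comp hlim
  have hlim1' : Tendsto (fun k => p (φ k)) atTop (𝓝[M.box] p') :=
    tendsto_nhdsWithin_iff.2 ⟨hlim1, Eventually.of_forall fun k => hp _⟩
  have hpj : ∀ j, Tendsto (fun k => p (φ k) j) atTop (𝓝 (p' j)) := fun j =>
    ((EuclideanSpace.proj (𝕜 := ℝ) j : Price N →L[ℝ] ℝ).continuous.tendsto p').comp hlim1
  have hqj : ∀ j, Tendsto (fun k => q (φ k) j) atTop (𝓝 (q' j)) := fun j =>
    ((EuclideanSpace.proj (𝕜 := ℝ) j : Price N →L[ℝ] ℝ).continuous.tendsto q').comp hlim2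
  have hη0 : Tendsto (fun k => b / 2 / ((φ k : ℝ) + 1)) atTop (𝓝 0) := by
    have h1 : Tendsto (fun k : ℕ => b / 2 * (1 / ((k : ℝ) + 1))) atTop (𝓝 (b / 2 * 0)) :=
      tendsto_one_div_add_atTop_nhds_zero_nat.const_mul _
    have h2 := h1.comp hφ.tendsto_atTop
    simp only [mul_zero] at h2
    exact h2.congr fun k => by simp [Function.comp, div_eq_mul_inv]
  have hslim : ∀ i j, Tendsto (fun k => partialD j (M.demand i) (p (φ k))) atTop
      (𝓝 (partialD j (M.demand i) p')) := fun i j =>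
    (continuousOn_partialD hreg i j p' hp').tendsto.comp hlim1'
  have hdlim : ∀ i, Tendsto (fun k => (M.tangentCoeffs (p (φ k))).demand i (q (φ k))) atTop
      (𝓝 ((M.tangentCoeffs p').demand i q')) := fun i => by
    simp only [demand_tangentCoeffs]
    exact ((continuousOn_demand hreg i p' hp').tendsto.comp hlim1').add
      (tendsto_finsetSum _ fun j _ => (hslim i j).mul ((hqj j).sub (hpj j)))
  have hmlim0 : ∀ i, Tendsto (fun k => (M.tangentCoeffs (p (φ k))).marginal i (q (φ k))) atTop
      (𝓝 ((M.tangentCoeffs p').marginal i q')) := fun i => by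
    refine (hdlim i).add ?_
    simp only [slope_tangentCoeffs]
    exact (hslim i i).mul (hqj i)
  have hmlim : ∀ i, Tendsto (fun k => (c (φ k)).marginal i (q (φ k))) atTop
      (𝓝 ((M.tangentCoeffs p').marginal i q')) := fun i => by
    refine (hmlim0 i).congr_dist (squeeze_zero (fun _ => dist_nonneg) (fun k => ?_)
      (by simpa using hη0.const_mul R))
    rw [dist_comm, Real.dist_eq]
    exact hRle _ (hp _) _ (hqbox _) _ _ (hclose (φ k)) i
  have hsl : ∀ i, Tendsto (fun k => (c (φ k)).slope i i) atTop
      (𝓝 (partialD i (M.demand i) p')) := fun i => by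
    refine (hslim i i).congr_dist (squeeze_zero (fun _ => dist_nonneg) (fun k => ?_) hη0)
    rw [dist_comm, Real.dist_eq]
    exact (hclose (φ k)).slope i i
  have hlimKKT : M.IsLinearKKT (M.tangentCoeffs p') q' := by
    have hk := fun k => (isLinearKKT_iff_marginal hreg (hs (φ k))).1 (hKKT (φ k))
    refine (isLinearKKT_iff_marginal hreg (slope_tangentCoeffs_neg hdem hp')).2 fun i =>
      ⟨hq' i, ?_, fun h => ?_, fun h => ?_⟩
    · have h1 : Tendsto (fun k => (c (φ k)).demand i (q (φ k))) atTop
          (𝓝 ((M.tangentCoeffs p').demand i q')) := by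
        have h2 := (hmlim i).sub ((hsl i).mul (hqj i))
        simp only [LinearCoeffs.marginal, slope_tangentCoeffs, add_sub_cancel_right] at h2
        exact h2
      exact ge_of_tendsto h1 (Eventually.of_forall fun k => (hk k i).2.1)
    · refine ge_of_tendsto (hmlim i) ?_
      filter_upwards [(hqj i).eventually (lt_mem_nhds h)] with k hlt
      exact (hk k i).2.2.1 hlt
    · refine le_of_tendsto (hmlim i) ?_
      filter_upwards [(hqj i).eventually (gt_mem_nhds h)] with k hlt
      exact (hk k i).2.2.2 hlt
  have hzlim : Tendsto (fun k => ‖q (φ k) - M.response (p (φ k))‖) atTop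
      (𝓝 ‖q' - M.response p'‖) :=
    (hlim2.sub ((hz.differentiable.continuousOn p' hp').tendsto.comp hlim1')).norm
  have := ge_of_tendsto hzlim (Eventually.of_forall fun k => hfar (φ k))
  rw [eq_response hz hp' hlimKKT, sub_self, norm_zero] at this
  linarith

/-- If the coefficients are close to the tangent ones, then the KKT system has a solution: the
linear system for vanishing marginal revenues is still nonsingular, and its solution lies close
to `response p`, hence off the bounds. -/
lemma exists_close_isLinearKKT (hreg : M.Regular) (hdem : M.DemandAssumption)
    (hz : M.ResponseAssumption γ) : ∃ η > 0, ∀ p ∈ M.box, ∀ c, M.Close p c η →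
      ∃ q, M.IsLinearKKT c q := by
  obtain ⟨b, hb, hslope⟩ := exists_own_slope_le hreg hdem
  obtain ⟨R, hR, hRle⟩ := M.exists_marginal_sub_le
  obtain ⟨ρ, hρ, hgap⟩ := exists_response_gap hz
  obtain ⟨C, hC, hCle⟩ := exists_norm_le_marginalLin hreg hdem hz
  -- the three bounds give a negative own slope, an injective linear part with inverse of norm at
  -- most `2 * C`, and a solution off the bounds of the price intervals
  obtain ⟨η, hη, hη1, hη2, hη3⟩ : ∃ η > 0, η ≤ b / 2 ∧ C * (N * (N + 1)) * η ≤ 1 / 2 ∧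
      2 * C * (N * R) * η ≤ ρ / 2 := by
    have h2 : 0 < C * (N * (N + 1)) + 1 := by positivity
    have h3 : 0 < 2 * C * (N * R) + 1 := by positivity
    refine ⟨min (b / 2) (min (1 / 2 / (C * (N * (N + 1)) + 1)) (ρ / 2 / (2 * C * (N * R) + 1))),
      by positivity, min_le_left _ _, ?_, ?_⟩
    · have h := (min_le_right (b / 2) (min (1 / 2 / (C * (N * (N + 1)) + 1))
        (ρ / 2 / (2 * C * (N * R) + 1)))).trans (min_le_left _ _)
      calc _ ≤ (C * (N * (N + 1)) + 1) * (1 / 2 / (C * (N * (N + 1)) + 1)) := by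
            gcongr; linarith
        _ = _ := by field_simp
    · have h := (min_le_right (b / 2) (min (1 / 2 / (C * (N * (N + 1)) + 1))
        (ρ / 2 / (2 * C * (N * R) + 1)))).trans (min_le_right _ _)
      calc _ ≤ (2 * C * (N * R) + 1) * (ρ / 2 / (2 * C * (N * R) + 1)) := by
            gcongr; linarith
        _ = _ := by field_simp
  refine ⟨η, hη, fun p hp c hc => ?_⟩
  have hs : ∀ i, c.slope i i < 0 := fun i => by
    linarith [(abs_le.1 (hc.slope i i)).2, hslope i p hp]
  have hlow : ∀ x : Price N, ‖x‖ ≤ 2 * C * ∑ i, |c.marginalLin x i| := fun x => by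
    have h1 : ∀ i, |(M.tangentCoeffs p).marginalLin x i| ≤
        |c.marginalLin x i| + (N + 1) * (η * ‖x‖) := fun i => by
      have e : (M.tangentCoeffs p).marginalLin x i = c.marginalLin x i
          - (∑ j, (c.slope i j - partialD j (M.demand i) p) * x j
            + (c.slope i i - partialD i (M.demand i) p) * x i) := by
        simp only [LinearCoeffs.marginalLin, LinearMap.coe_mk, AddHom.coe_mk, slope_tangentCoeffs,
          sub_mul, Finset.sum_sub_distrib]
        ring
      have h2 : ∀ j, |(c.slope i j - partialD j (M.demand i) p) * x j| ≤ η * ‖x‖ := fun j => by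
        rw [abs_mul]
        exact mul_le_mul (hc.slope i j) (EuclideanSpace.abs_apply_le_norm x j) (abs_nonneg _) hη.le
      have h3 : |∑ j, (c.slope i j - partialD j (M.demand i) p) * x j| ≤ N * (η * ‖x‖) := by
        refine (Finset.abs_sum_le_sum_abs _ _).trans ?_
        simpa using Finset.sum_le_sum fun j (_ : j ∈ Finset.univ) => h2 j
      rw [e]
      refine (abs_sub _ _).trans (add_le_add_right ((abs_add_le _ _).trans ?_) _)
      linarith [h2 i]
    have h4 := Finset.sum_le_sum fun i (_ : i ∈ Finset.univ) => h1 i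
    rw [Finset.sum_add_distrib, Finset.sum_const, Finset.card_univ, Fintype.card_fin,
      nsmul_eq_mul] at h4
    have h5 := (hCle p hp x).trans (mul_le_mul_of_nonneg_left h4 hC.le)
    nlinarith [norm_nonneg x, mul_le_mul_of_nonneg_right hη2 (norm_nonneg x)]
  have hinj : Function.Injective c.marginalLin := by
    refine (injective_iff_map_eq_zero _).2 fun x hx => ?_
    have := hlow x
    rw [hx] at this
    simpa using this
  have hsurj : Function.Surjective c.marginalLin :=
    (LinearMap.injective_iff_surjective_of_finrank_eq_finrank (by simp)).1 hinj
  obtain ⟨x, hx⟩ := hsurj fun i => -c.marginal i (M.response p)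
  have hzbox := response_mem_box hz hp
  have hxle : ∀ i, |x i| ≤ ρ / 2 := fun i => by
    have h1 : ∀ i, |c.marginalLin x i| ≤ R * η := fun i => by
      have h2 := hRle p hp _ hzbox c η hc i
      rw [marginal_eq_zero hreg (slope_tangentCoeffs_neg hdem hp) (hz.interior p hp)
        (response_spec hz hp), sub_zero] at h2
      rw [hx, abs_neg]
      exact h2
    have h3 : ∑ i, |c.marginalLin x i| ≤ N * (R * η) := by
      simpa using Finset.sum_le_sum fun i (_ : i ∈ Finset.univ) => h1 i
    have h4 := (hlow x).trans (mul_le_mul_of_nonneg_left h3 (by positivity))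
    linarith [EuclideanSpace.abs_apply_le_norm x i]
  refine ⟨M.response p + x, isLinearKKT_of_interior hreg hs (fun i => ?_) fun i => ?_⟩
  · have h1 := abs_le.1 (hxle i)
    have h2 := hgap i p hp
    rw [PiLp.add_apply]
    exact ⟨by linarith [h1.1, h2.1], by linarith [h1.2, h2.2]⟩
  · have h1 := c.marginal_eq_add i (M.response p) (M.response p + x)
    rw [add_sub_cancel_left, hx, add_neg_cancel] at h1
    exact h1

/-- The next prices deviate from the noiseless best responses by at most a constant times the
error of the coefficients. When that error is large, this holds because all prices are
bounded. -/
theorem exists_norm_sub_response_le (hreg : M.Regular) (hdem : M.DemandAssumption)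
    (hz : M.ResponseAssumption γ) : ∃ C > 0, ∀ p ∈ M.box, ∀ q ∈ M.box, ∀ c η,
      0 ≤ η → M.Close p c η → ((∃ q, M.IsLinearKKT c q) → M.IsLinearKKT c q) →
      ‖q - M.response p‖ ≤ C * η := by
  obtain ⟨b, hb, hslope⟩ := exists_own_slope_le hreg hdem
  obtain ⟨R, hR, hRle⟩ := M.exists_marginal_sub_le
  obtain ⟨ρ, hρ, hgap⟩ := exists_response_gap hz
  obtain ⟨C, hC, hCle⟩ := exists_norm_le_marginalLin hreg hdem hz
  obtain ⟨η₁, hη₁, hnear⟩ := exists_close_response hreg hdem hz hρ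
  obtain ⟨η₂, hη₂, hex⟩ := exists_close_isLinearKKT hreg hdem hz
  obtain ⟨D, hD, hbox⟩ := M.exists_bound_box
  set η₀ := min (b / 2) (min η₁ η₂) with hη₀def
  have hη₀ : 0 < η₀ := by positivity
  refine ⟨C * (N * R) + 2 * D / η₀, by positivity, fun p hp q hq c η hη hc hsel => ?_⟩
  have hnn1 : 0 ≤ C * (N * R) * η := by positivity
  have hnn2 : 0 ≤ 2 * D / η₀ * η := by positivity
  rw [add_mul]
  rcases le_or_gt η η₀ with hle | hgt
  · have hle1 : η ≤ b / 2 := hle.trans (min_le_left _ _)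
    have hle2 : η ≤ η₁ := hle.trans ((min_le_right _ _).trans (min_le_left _ _))
    have hle3 : η ≤ η₂ := hle.trans ((min_le_right _ _).trans (min_le_right _ _))
    have hs : ∀ i, c.slope i i < 0 := fun i => by
      linarith [(abs_le.1 (hc.slope i i)).2, hslope i p hp]
    have hKKT := hsel (hex p hp c (hc.mono hle3))
    have hlt := hnear p hp c q (hc.mono hle2) hKKT
    have hint : ∀ i, M.lo i < q i ∧ q i < M.hi i := fun i => by
      have h1 := abs_lt.1 ((EuclideanSpace.abs_apply_le_norm (q - M.response p) i).trans_lt hlt)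
      rw [PiLp.sub_apply] at h1
      have h2 := hgap i p hp
      exact ⟨by linarith [h1.1, h2.1], by linarith [h1.2, h2.2]⟩
    have h1 : ∀ i, |(M.tangentCoeffs p).marginalLin (q - M.response p) i| ≤ R * η := fun i => by
      have h2 := (M.tangentCoeffs p).marginal_eq_add i (M.response p) q
      rw [marginal_eq_zero hreg (slope_tangentCoeffs_neg hdem hp) (hz.interior p hp)
        (response_spec hz hp), zero_add] at h2
      have h3 := hRle p hp q hq c η hc i
      rw [marginal_eq_zero hreg hs hint hKKT, zero_sub, abs_neg] at h3
      rwa [← h2]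
    have h3 : ∑ i, |(M.tangentCoeffs p).marginalLin (q - M.response p) i| ≤ N * (R * η) := by
      simpa using Finset.sum_le_sum fun i (_ : i ∈ Finset.univ) => h1 i
    have h4 := (hCle p hp (q - M.response p)).trans (mul_le_mul_of_nonneg_left h3 hC.le)
    linarith
  · have h1 : ‖q - M.response p‖ ≤ 2 * D := by
      linarith [norm_sub_le q (M.response p), hbox q hq, hbox _ (response_mem_box hz hp)]
    have h2 : 2 * D ≤ 2 * D / η₀ * η := by
      rw [div_mul_eq_mul_div, le_div_iff₀ hη₀]
      gcongr
    linarith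

end Market

/-! ### Batches and price shifts -/

lemma one_le_scale {I₀ v : ℝ} (hI₀ : 1 ≤ I₀) (hv : 1 < v) (n : ℕ) : 1 ≤ I₀ * v ^ n :=
  one_le_mul_of_one_le_of_one_le hI₀ (one_le_pow₀ hv.le)

lemma batch_pos {I₀ v : ℝ} (hI₀ : 1 ≤ I₀) (hv : 1 < v) (n : ℕ) : 0 < batch I₀ v n :=
  Nat.floor_pos.2 (one_le_scale hI₀ hv n)

lemma shift_pos {I₀ v : ℝ} (hI₀ : 1 ≤ I₀) (hv : 1 < v) (n : ℕ) : 0 < shift I₀ v n :=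
  Real.rpow_pos_of_pos (by exact_mod_cast batch_pos hI₀ hv n) _

lemma shift_le_one {I₀ v : ℝ} (hI₀ : 1 ≤ I₀) (hv : 1 < v) (n : ℕ) : shift I₀ v n ≤ 1 :=
  Real.rpow_le_one_of_one_le_of_nonpos (by exact_mod_cast batch_pos hI₀ hv n) (by norm_num)

/-! ### Least squares with as many parameters as design points -/

lemma Finset.sum_mul_eq_zero_of_sum_sq_le {ι : Type*} (S : Finset ι) (r h : ι → ℝ)
    (hmin : ∀ t : ℝ, ∑ s ∈ S, r s ^ 2 ≤ ∑ s ∈ S, (r s - t * h s) ^ 2) :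
    ∑ s ∈ S, r s * h s = 0 := by
  set A := ∑ s ∈ S, r s * h s with hA
  set B := ∑ s ∈ S, h s ^ 2 with hB
  have hB0 : 0 ≤ B := Finset.sum_nonneg fun _ _ => sq_nonneg _
  have key : ∀ t : ℝ, 0 ≤ t ^ 2 * B - 2 * t * A := fun t => by
    have e : ∑ s ∈ S, (r s - t * h s) ^ 2 = ∑ s ∈ S, r s ^ 2 + (t ^ 2 * B - 2 * t * A) := by
      rw [hA, hB, Finset.mul_sum, Finset.mul_sum, ← Finset.sum_sub_distrib,
        ← Finset.sum_add_distrib]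
      exact Finset.sum_congr rfl fun s _ => by ring
    have := hmin t
    rw [e] at this
    linarith
  have h1 := key (A / (B + 1))
  have e : (A / (B + 1)) ^ 2 * B - 2 * (A / (B + 1)) * A
      = -(A ^ 2 * (B + 2) / (B + 1) ^ 2) := by
    field_simp; ring
  rw [e] at h1
  by_contra hne
  have : 0 < A ^ 2 * (B + 2) / (B + 1) ^ 2 := by positivity
  linarith

/-- The design point of interval number `k` of a stage: `p` itself for `k = 0`, and for
`k = j + 1` the price of firm `j` is raised by `δ`. -/
noncomputable def groupPrice {N : ℕ} (p : Price N) (δ : ℝ) (k : ℕ) : Price N :=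
  WithLp.toLp 2 fun i => p i + if k = (i : ℕ) + 1 then δ else 0

lemma stagePrice_eq {N : ℕ} (I₀ v : ℝ) (n : ℕ) (p : Price N) (s : ℕ) :
    stagePrice I₀ v n p s = groupPrice p (shift I₀ v n) (s / batch I₀ v n) := rfl

lemma groupPrice_zero {N : ℕ} (p : Price N) (δ : ℝ) : groupPrice p δ 0 = p := by
  ext i; simp [groupPrice]

lemma groupPrice_succ {N : ℕ} (p : Price N) (δ : ℝ) (j : Fin N) :
    groupPrice p δ (j + 1) = p + δ • EuclideanSpace.single j 1 := by
  ext i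
  by_cases h : i = j
  · subst h; simp [groupPrice]
  · have h' : (j : ℕ) ≠ i := fun h' => h (Fin.ext h').symm
    simp [groupPrice, h, h']

/-- The `N + 1` design points are affinely independent, so the indicator function of each of them
extends to an affine function of the prices. -/
lemma exists_affine_indicator {N : ℕ} (p : Price N) {δ : ℝ} (hδ : δ ≠ 0) {k : ℕ} (hk : k < N + 1) :
    ∃ (a : ℝ) (g : Fin N → ℝ), ∀ l < N + 1,
      a + ∑ j, g j * groupPrice p δ l j = if l = k then 1 else 0 := by
  rcases k with _ | k
  · refine ⟨1 + ∑ j, δ⁻¹ * p j, fun _ => -δ⁻¹, fun l hl => ?_⟩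
    rcases l with _ | l
    · simp [groupPrice_zero, ← Finset.mul_sum]
    · have h := groupPrice_succ p δ ⟨l, by omega⟩
      simp only at h
      rw [h]
      simp [mul_add, Finset.sum_add_distrib, hδ]
  · refine ⟨-(δ⁻¹ * p ⟨k, by omega⟩), Pi.single ⟨k, by omega⟩ δ⁻¹, fun l _ => ?_⟩
    rw [Finset.sum_eq_single ⟨k, by omega⟩ (fun j _ hj => by simp [hj]) (by simp)]
    by_cases h : l = k + 1
    · simp [groupPrice, h, mul_add, hδ]
    · simp [groupPrice, h]

/-- The average of the demand shocks of firm `i` over interval number `k` of stage `n`. -/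
noncomputable def noiseMean {N : ℕ} (I₀ v : ℝ) (e : ℕ → Fin N → ℝ) (n k : ℕ) (i : Fin N) : ℝ :=
  (∑ s ∈ Finset.Ico (k * batch I₀ v n) ((k + 1) * batch I₀ v n),
    e (stageStart N I₀ v n + 1 + s) i) / batch I₀ v n

/-- The total size of the averaged demand shocks of stage `n`. -/
noncomputable def totalNoise {N : ℕ} (I₀ v : ℝ) (e : ℕ → Fin N → ℝ) (n : ℕ) : ℝ :=
  ∑ k ∈ Finset.range (N + 1), ∑ i, |noiseMean I₀ v e n k i|

lemma abs_noiseMean_le {N : ℕ} (I₀ v : ℝ) (e : ℕ → Fin N → ℝ) (n : ℕ) {k : ℕ} (hk : k < N + 1)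
    (i : Fin N) : |noiseMean I₀ v e n k i| ≤ totalNoise I₀ v e n :=
  (Finset.single_le_sum (f := fun i => |noiseMean I₀ v e n k i|) (fun _ _ => abs_nonneg _)
    (Finset.mem_univ i)).trans
  (Finset.single_le_sum (f := fun k => ∑ i, |noiseMean I₀ v e n k i|)
    (fun _ _ => Finset.sum_nonneg fun _ _ => abs_nonneg _) (Finset.mem_range.2 hk))

lemma totalNoise_nonneg {N : ℕ} (I₀ v : ℝ) (e : ℕ → Fin N → ℝ) (n : ℕ) :
    0 ≤ totalNoise I₀ v e n :=
  Finset.sum_nonneg fun _ _ => Finset.sum_nonneg fun _ _ => abs_nonneg _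

namespace Market

variable {N : ℕ} {M : Market N} {γ : ℝ}

/-- The least squares fit interpolates the averages of the observed demands at the `N + 1` design
points. This follows from the normal equations for the indicator functions of these points. -/
lemma demand_groupPrice_of_leastSquares {I₀ v : ℝ} (hI₀ : 1 ≤ I₀) (hv : 1 < v)
    (e : ℕ → Fin N → ℝ) (n : ℕ) (p : Price N) (c : LinearCoeffs N) (i : Fin N)
    (hmin : ∀ a b, M.stageResidual I₀ v e n p i (c.α i) (c.β i) ≤
      M.stageResidual I₀ v e n p i a b) {k : ℕ} (hk : k < N + 1) :
    c.demand i (groupPrice p (shift I₀ v n) k) =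
      M.demand i (groupPrice p (shift I₀ v n) k) + noiseMean I₀ v e n k i := by
  set δ := shift I₀ v n with hδ
  have hδ0 : δ ≠ 0 := (shift_pos hI₀ hv n).ne'
  have hIpos := batch_pos hI₀ hv n
  set I := batch I₀ v n with hI
  obtain ⟨a, g, hag⟩ := exists_affine_indicator p hδ0 hk
  set r : ℕ → ℝ := fun s => M.stageDemand I₀ v e n p s i - c.demand i (stagePrice I₀ v n p s)
    with hr
  have hdiv : ∀ s ∈ Finset.range ((N + 1) * I), s / I < N + 1 := fun s hs =>
    Nat.div_lt_of_lt_mul (by rw [mul_comm]; exact Finset.mem_range.1 hs)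
  have hort : ∑ s ∈ Finset.range ((N + 1) * I), r s * (if s / I = k then 1 else 0) = 0 := by
    refine Finset.sum_mul_eq_zero_of_sum_sq_le _ _ _ fun t => ?_
    have h := hmin (c.α i + t * a) (fun j => c.β i j + t * (if j = i then -g j else g j))
    refine h.trans (le_of_eq (Finset.sum_congr rfl fun s hs => ?_))
    rw [← hag _ (hdiv s hs), hr]
    simp only [LinearCoeffs.demand, affineDemand_eq, stagePrice_eq, ← hδ, ← hI]
    congr 1
    have e1 : ∀ j, (if j = i then -(c.β i j + t * (if j = i then -g j else g j))
        else c.β i j + t * (if j = i then -g j else g j)) * groupPrice p δ (s / I) j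
        = (if j = i then -c.β i j else c.β i j) * groupPrice p δ (s / I) j
          + t * (g j * groupPrice p δ (s / I) j) := fun j => by
      split_ifs <;> ring
    simp only [e1, Finset.sum_add_distrib, ← Finset.mul_sum]
    ring
  have hfilter : (Finset.range ((N + 1) * I)).filter (fun s => s / I = k)
      = Finset.Ico (k * I) ((k + 1) * I) := by
    ext s
    simp only [Finset.mem_filter, Finset.mem_range, Finset.mem_Ico]
    rw [Nat.div_eq_iff hIpos]
    have h1 : (k + 1) * I ≤ (N + 1) * I := Nat.mul_le_mul_right _ (by omega)
    have h2 : (k + 1) * I = k * I + I := by ring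
    omega
  simp only [mul_ite, mul_one, mul_zero] at hort
  rw [← Finset.sum_filter, hfilter] at hort
  have hgroup : ∑ s ∈ Finset.Ico (k * I) ((k + 1) * I), r s
      = ∑ s ∈ Finset.Ico (k * I) ((k + 1) * I), (M.demand i (groupPrice p δ k)
        - c.demand i (groupPrice p δ k) + e (stageStart N I₀ v n + 1 + s) i) := by
    refine Finset.sum_congr rfl fun s hs => ?_
    rw [← hfilter] at hs
    have hsk := (Finset.mem_filter.1 hs).2
    simp only [hr, stageDemand, stagePrice_eq, ← hI, ← hδ, hsk]
    ring
  have hcard : (k + 1) * I - k * I = I := by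
    rw [Nat.succ_mul, Nat.add_sub_cancel_left]
  rw [hgroup, Finset.sum_add_distrib, Finset.sum_const, Nat.card_Ico, hcard, nsmul_eq_mul] at hort
  have hI0 : (I : ℝ) ≠ 0 := by exact_mod_cast hIpos.ne'
  rw [noiseMean, ← hI]
  field_simp
  linarith

/-! ### The error of the estimates -/

/-- The difference quotients of the demands approximate the partial derivatives to first order,
uniformly over the set of prices; for small shifts the shifted prices stay in the neighbourhood
where the demands are smooth. -/
lemma exists_differenceQuotient_bound (hreg : M.Regular) : ∃ δ₀ > 0, ∃ L > 0, ∀ i j : Fin N,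
    ∀ p ∈ M.box, ∀ δ, 0 < δ → δ ≤ δ₀ →
      |M.demand i (p + δ • EuclideanSpace.single j 1) - M.demand i p
        - δ * partialD j (M.demand i) p| ≤ L * δ ^ 2 := by
  obtain ⟨U, hU, hbU, hsm⟩ := hreg.smooth
  obtain ⟨δ₀, hδ₀, hsub⟩ := isCompact_box.exists_cthickening_subset_open hU hbU
  set K := Metric.cthickening δ₀ M.box with hK
  have hKc : IsCompact K := isCompact_box.cthickening
  have hKconv : Convex ℝ K := convex_box.cthickening δ₀
  have hC2 : ∀ i, ∀ x ∈ K, ContDiffAt ℝ 2 (M.demand i) x := fun i x hx =>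
    (hsm i).contDiffAt (hU.mem_nhds (hsub hx))
  have hC1 : ∀ i, ∀ x ∈ K, ContDiffAt ℝ 1 (fderiv ℝ (M.demand i)) x := fun i x hx =>
    (hC2 i x hx).fderiv_right (by norm_num)
  have hL : ∀ i, ∃ L, ∀ x ∈ K, ‖fderiv ℝ (fderiv ℝ (M.demand i)) x‖ ≤ L := fun i =>
    hKc.exists_bound_of_continuousOn fun x hx =>
      ((hC1 i x hx).fderiv_right (m := 0) (by norm_num)).continuousAt.continuousWithinAt
  choose L hL using hL
  refine ⟨δ₀, hδ₀, 1 + ∑ i, |L i|, by positivity, fun i j p hp δ hδ hδle => ?_⟩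
  have hLi : L i ≤ 1 + ∑ i, |L i| := by
    have := Finset.single_le_sum (f := fun i => |L i|) (fun _ _ => abs_nonneg _) (Finset.mem_univ i)
    linarith [le_abs_self (L i)]
  have hpK : p ∈ K := Metric.self_subset_cthickening _ hp
  set y := p + δ • EuclideanSpace.single j (1 : ℝ) with hy
  have hyp : y - p = δ • EuclideanSpace.single j (1 : ℝ) := by rw [hy, add_sub_cancel_left]
  have hnorm : ‖y - p‖ = δ := by rw [hyp, norm_smul]; simp [abs_of_pos hδ]
  have hyK : y ∈ K := Metric.mem_cthickening_of_dist_le y p δ₀ _ hp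
    (by rw [dist_eq_norm, hnorm]; exact hδle)
  have hseg : segment ℝ p y ⊆ K := hKconv.segment_subset hpK hyK
  have hlip : ∀ x ∈ segment ℝ p y,
      ‖fderiv ℝ (M.demand i) x - fderiv ℝ (M.demand i) p‖ ≤ (1 + ∑ i, |L i|) * δ := fun x hx => by
    have h1 := hKconv.norm_image_sub_le_of_norm_fderiv_le (𝕜 := ℝ)
      (fun x hx => (hC1 i x hx).differentiableAt (by norm_num)) (hL i) hpK (hseg hx)
    have h2 : ‖x - p‖ ≤ δ := by rw [← hnorm]; exact norm_sub_le_of_mem_segment hx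
    exact h1.trans (mul_le_mul hLi h2 (norm_nonneg _) (by positivity))
  have h := (convex_segment p y).norm_image_sub_le_of_norm_fderiv_le' (𝕜 := ℝ)
    (fun x hx => (hC2 i x (hseg hx)).differentiableAt (by norm_num)) hlip
    (left_mem_segment ℝ p y) (right_mem_segment ℝ p y)
  rw [hnorm, hyp, map_smul, smul_eq_mul, Real.norm_eq_abs] at h
  rw [partialD]
  linarith

lemma exists_close_of_interpolation (hreg : M.Regular) : ∃ δ₀ > 0, ∃ L > 0, ∀ p ∈ M.box,
    ∀ δ, 0 < δ → δ ≤ δ₀ → δ ≤ 1 → ∀ (c : LinearCoeffs N) (m : ℕ → Fin N → ℝ) (A : ℝ),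
      (∀ k < N + 1, ∀ i, |m k i| ≤ A) →
      (∀ k < N + 1, ∀ i, c.demand i (groupPrice p δ k) =
        M.demand i (groupPrice p δ k) + m k i) → M.Close p c (L * δ + 2 * A / δ) := by
  obtain ⟨δ₀, hδ₀, L, hL, h⟩ := exists_differenceQuotient_bound hreg
  refine ⟨δ₀, hδ₀, L, hL, fun p hp δ hδ hδle hδ1 c m A hm hfit => ⟨fun i => ?_, fun i j => ?_⟩⟩
  · have h1 := hfit 0 (by omega) i
    rw [groupPrice_zero] at h1
    rw [h1, add_sub_cancel_left]
    have h2 := hm 0 (by omega) i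
    have hA : 0 ≤ A := (abs_nonneg _).trans h2
    have h3 : 2 * A ≤ 2 * A / δ := le_div_self (by positivity) hδ hδ1
    have : 0 ≤ L * δ := by positivity
    linarith
  · have h0 := hfit 0 (by omega) i
    rw [groupPrice_zero] at h0
    have h1 := hfit (j + 1) (by omega) i
    rw [groupPrice_succ, c.demand_eq_add i p, h0] at h1
    have hsum : ∑ l, c.slope i l * ((p + δ • EuclideanSpace.single j (1 : ℝ) : Price N) l - p l)
        = c.slope i j * δ := by
      rw [Finset.sum_eq_single j (fun l _ hl => by simp [hl]) (by simp)]
      simp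
    rw [hsum] at h1
    have h2 := hm 0 (by omega) i
    have h3 := hm (j + 1) (by omega) i
    have h4 := h i j p hp δ hδ hδle
    have e : δ * (c.slope i j - partialD j (M.demand i) p)
        = (M.demand i (p + δ • EuclideanSpace.single j 1) - M.demand i p
          - δ * partialD j (M.demand i) p) + m (j + 1) i - m 0 i := by linarith
    have h5 : δ * |c.slope i j - partialD j (M.demand i) p| ≤ L * δ ^ 2 + 2 * A := by
      rw [← abs_of_pos hδ, ← abs_mul, abs_of_pos hδ, e]
      rw [abs_le] at *
      constructor <;> linarith [h2.1, h2.2, h3.1, h3.2, h4.1, h4.2]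
    have e2 : L * δ + 2 * A / δ = (L * δ ^ 2 + 2 * A) / δ := by field_simp
    rw [e2, le_div_iff₀ hδ]
    linarith

end Market

/-- In every run of the algorithm, the next prices deviate from the noiseless best responses by at
most a constant times the shift plus the averaged noise divided by the shift. The bound
does not refer to the prices of the stage, so no conditioning on the past is needed later. -/
theorem IsDDEP.exists_norm_sub_response_le {N : ℕ} {M : Market N} {γ : ℝ} (hreg : M.Regular)
    (hdem : M.DemandAssumption) (hz : M.ResponseAssumption γ) {I₀ v : ℝ} (hI₀ : 1 ≤ I₀)
    (hv : 1 < v) {Ω : Type*} [MeasurableSpace Ω] (ε : ℕ → Ω → Fin N → ℝ) :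
    ∃ C > 0, ∀ phat chat, IsDDEP M I₀ v ε phat chat → ∀ n ω,
      ‖phat (n + 1) ω - M.response (phat n ω)‖ ≤
        C * (shift I₀ v n + totalNoise I₀ v (fun t => ε t ω) n / shift I₀ v n) := by
  obtain ⟨C, hC, hstab⟩ := Market.exists_norm_sub_response_le hreg hdem hz
  obtain ⟨δ₀, hδ₀, L, hL, hclose⟩ := Market.exists_close_of_interpolation hreg
  obtain ⟨D, hD, hbox⟩ := M.exists_bound_box
  refine ⟨C * (L + 2) + 2 * D / δ₀, by positivity, fun phat chat h n ω => ?_⟩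
  have hδ := shift_pos hI₀ hv n
  have hδ1 := shift_le_one hI₀ hv n
  have hA := totalNoise_nonneg I₀ v (fun t => ε t ω) n
  set δ := shift I₀ v n
  set A := totalNoise I₀ v (fun t => ε t ω) n
  have hAδ : 0 ≤ A / δ := by positivity
  rcases le_or_gt δ δ₀ with hle | hgt
  · have h1 := hclose (phat n ω) (h.mem_box n ω) δ hδ hle hδ1 (chat (n + 1) ω)
      (noiseMean I₀ v (fun t => ε t ω) n) A (fun k hk i => abs_noiseMean_le I₀ v _ n hk i)
      (fun k hk i => Market.demand_groupPrice_of_leastSquares hI₀ hv _ n _ _ i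
        (h.leastSquares n ω i) hk)
    have h2 := hstab _ (h.mem_box n ω) _ (h.mem_box (n + 1) ω) _ _ (by positivity) h1
      (h.equilibrium n ω)
    refine h2.trans ?_
    have e : L * δ + 2 * A / δ ≤ (L + 2) * (δ + A / δ) := by
      rw [mul_div_assoc]; nlinarith
    have h3 : 0 ≤ 2 * D / δ₀ * (δ + A / δ) := by positivity
    nlinarith [mul_le_mul_of_nonneg_left e hC.le]
  · have h1 : ‖phat (n + 1) ω - M.response (phat n ω)‖ ≤ 2 * D := by
      linarith [norm_sub_le (phat (n + 1) ω) (M.response (phat n ω)), hbox _ (h.mem_box (n + 1) ω),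
        hbox _ (Market.response_mem_box hz (h.mem_box n ω))]
    have h2 : 2 * D ≤ 2 * D / δ₀ * (δ + A / δ) := by
      rw [div_mul_eq_mul_div, le_div_iff₀ hδ₀]
      gcongr
      linarith
    have h3 : 0 ≤ C * (L + 2) * (δ + A / δ) := by positivity
    linarith

/-! ### Growth of the batches -/

lemma batch_rpow_eq (I₀ v : ℝ) (n : ℕ) :
    (batch I₀ v n : ℝ) ^ (-(1 / 2) : ℝ) = (√(batch I₀ v n : ℝ))⁻¹ := by
  rw [Real.rpow_neg (Nat.cast_nonneg _), Real.sqrt_eq_rpow]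

lemma shift_sq (I₀ v : ℝ) (n : ℕ) : shift I₀ v n ^ 2 = (√(batch I₀ v n : ℝ))⁻¹ := by
  rw [← batch_rpow_eq, shift, ← Real.rpow_mul_natCast (Nat.cast_nonneg _)]
  norm_num

lemma inv_sqrt_batch_le {I₀ v : ℝ} (hI₀ : 1 ≤ I₀) (hv : 1 < v) (n : ℕ) :
    (√(batch I₀ v n : ℝ))⁻¹ ≤ 2 * ((√v)⁻¹) ^ n := by
  have hvn : 0 < v ^ n := by positivity
  have h1 : v ^ n / 4 ≤ batch I₀ v n := by
    have h2 : I₀ * v ^ n < batch I₀ v n + 1 := Nat.lt_floor_add_one _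
    have h3 : (1 : ℝ) ≤ batch I₀ v n := by exact_mod_cast batch_pos hI₀ hv n
    nlinarith
  have h2 : √v ^ n / 2 ≤ √(batch I₀ v n : ℝ) := by
    refine Real.le_sqrt_of_sq_le (le_trans (le_of_eq ?_) h1)
    rw [div_pow, ← pow_mul, mul_comm n 2, pow_mul, Real.sq_sqrt (by linarith)]
    norm_num
  have hs : 0 < √v ^ n := pow_pos (Real.sqrt_pos.2 (by linarith)) n
  calc (√(batch I₀ v n : ℝ))⁻¹ ≤ (√v ^ n / 2)⁻¹ := inv_anti₀ (by positivity) h2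
    _ = 2 * ((√v)⁻¹) ^ n := by rw [inv_pow, inv_div, div_eq_mul_inv]

lemma inv_sqrt_pow_le {I₀ v : ℝ} (hI₀ : 1 ≤ I₀) (hv : 1 < v) (n : ℕ) :
    ((√v)⁻¹) ^ n ≤ √I₀ * (√(batch I₀ v n : ℝ))⁻¹ := by
  have h1 : (batch I₀ v n : ℝ) ≤ I₀ * v ^ n :=
    Nat.floor_le (by linarith [one_le_scale hI₀ hv n])
  have h2 : √(batch I₀ v n : ℝ) ≤ √I₀ * √v ^ n := by
    refine Real.sqrt_le_iff.2 ⟨by positivity, h1.trans (le_of_eq ?_)⟩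
    rw [mul_pow, ← pow_mul, mul_comm n 2, pow_mul, Real.sq_sqrt (by linarith),
      Real.sq_sqrt (by linarith)]
  have hs : 0 < √v ^ n := pow_pos (Real.sqrt_pos.2 (by linarith)) n
  have hb : 0 < √(batch I₀ v n : ℝ) := Real.sqrt_pos.2 (by exact_mod_cast batch_pos hI₀ hv n)
  rw [inv_pow, ← div_eq_mul_inv, inv_le_iff_one_le_mul₀ hs, div_mul_eq_mul_div, le_div_iff₀ hb]
  linarith

/-! ### Moments of the averaged noise -/

section Noise

variable {N : ℕ} {Ω : Type*} [MeasurableSpace Ω] {μ : Measure Ω} {ε : ℕ → Ω → Fin N → ℝ}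

lemma memLp_noiseMean (hε_memLp : ∀ t i, MemLp (fun ω => ε t ω i) 2 μ) (I₀ v : ℝ) (n k : ℕ)
    (i : Fin N) : MemLp (fun ω => noiseMean I₀ v (fun t => ε t ω) n k i) 2 μ := by
  simp only [noiseMean, div_eq_mul_inv]
  exact (memLp_finsetSum _ fun s _ => hε_memLp _ i).mul_const _

lemma memLp_totalNoise (hε_memLp : ∀ t i, MemLp (fun ω => ε t ω i) 2 μ) (I₀ v : ℝ) (n : ℕ) :
    MemLp (fun ω => totalNoise I₀ v (fun t => ε t ω) n) 2 μ :=
  memLp_finsetSum _ fun k _ => memLp_finsetSum _ fun i _ =>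
    (memLp_noiseMean hε_memLp I₀ v n k i).abs

variable [IsProbabilityMeasure μ]

lemma memLp_shift_add_noise (hε_memLp : ∀ t i, MemLp (fun ω => ε t ω i) 2 μ) (I₀ v : ℝ) (n : ℕ) :
    MemLp (fun ω => shift I₀ v n + totalNoise I₀ v (fun t => ε t ω) n / shift I₀ v n) 2 μ := by
  have h1 : MemLp (fun ω => totalNoise I₀ v (fun t => ε t ω) n * (shift I₀ v n)⁻¹) 2 μ :=
    (memLp_totalNoise hε_memLp I₀ v n).mul_const _
  have h2 : MemLp (fun _ : Ω => shift I₀ v n) 2 μ := memLp_const _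
  simp only [div_eq_mul_inv]
  exact h2.add h1

lemma integral_noiseMean_sq (hε_indep : iIndepFun ε μ)
    (hε_memLp : ∀ t i, MemLp (fun ω => ε t ω i) 2 μ) (hε_mean : ∀ t i, ∫ ω, ε t ω i ∂μ = 0)
    {σ : ℝ} (hε_var : ∀ t i, variance (fun ω => ε t ω i) μ = σ ^ 2)
    {I₀ v : ℝ} (hI₀ : 1 ≤ I₀) (hv : 1 < v) (n k : ℕ) (i : Fin N) :
    ∫ ω, noiseMean I₀ v (fun t => ε t ω) n k i ^ 2 ∂μ = σ ^ 2 / batch I₀ v n := by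
  have hIpos := batch_pos hI₀ hv n
  set I := batch I₀ v n with hI
  set S := Finset.Ico (k * I) ((k + 1) * I) with hS
  set X : ℕ → Ω → ℝ := fun s ω => ε (stageStart N I₀ v n + 1 + s) ω i with hX
  have hcard : S.card = I := by rw [hS, Nat.card_Ico, Nat.succ_mul, Nat.add_sub_cancel_left]
  have hvar : variance (∑ s ∈ S, X s) μ = I * σ ^ 2 := by
    rw [IndepFun.variance_sum (fun s _ => hε_memLp _ i) fun s _ t _ hst => ?_]
    · simp only [hε_var, Finset.sum_const, hcard, nsmul_eq_mul]
    · exact (hε_indep.indepFun (by omega : stageStart N I₀ v n + 1 + s ≠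
        stageStart N I₀ v n + 1 + t)).comp (measurable_pi_apply i) (measurable_pi_apply i)
  have hmean : ∫ ω, (∑ s ∈ S, X s) ω ∂μ = 0 := by
    simp only [Finset.sum_apply]
    rw [integral_finsetSum _ fun s _ => (hε_memLp _ i).integrable (by norm_num)]
    exact Finset.sum_eq_zero fun s _ => hε_mean _ i
  have hmem : MemLp (∑ s ∈ S, X s) 2 μ := memLp_finsetSum' _ fun s _ => hε_memLp _ i
  have hsq : ∫ ω, (∑ s ∈ S, X s) ω ^ 2 ∂μ = I * σ ^ 2 := by
    rw [← hvar, variance_of_integral_eq_zero hmem.aemeasurable hmean]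
  have hI0 : (I : ℝ) ≠ 0 := by exact_mod_cast hIpos.ne'
  have e : ∀ ω, noiseMean I₀ v (fun t => ε t ω) n k i ^ 2
      = (∑ s ∈ S, X s) ω ^ 2 / (I : ℝ) ^ 2 := fun ω => by
    rw [noiseMean, ← hI, ← hS, div_pow, Finset.sum_apply]
  simp only [e]
  rw [integral_div, hsq]
  field_simp

lemma integral_totalNoise_sq_le (hε_indep : iIndepFun ε μ)
    (hε_memLp : ∀ t i, MemLp (fun ω => ε t ω i) 2 μ) (hε_mean : ∀ t i, ∫ ω, ε t ω i ∂μ = 0)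
    {σ : ℝ} (hε_var : ∀ t i, variance (fun ω => ε t ω i) μ = σ ^ 2)
    {I₀ v : ℝ} (hI₀ : 1 ≤ I₀) (hv : 1 < v) (n : ℕ) :
    ∫ ω, totalNoise I₀ v (fun t => ε t ω) n ^ 2 ∂μ ≤
      ((N + 1) * N) ^ 2 * (σ ^ 2 / batch I₀ v n) := by
  have hpt : ∀ ω, totalNoise I₀ v (fun t => ε t ω) n ^ 2 ≤
      (N + 1) * N * ∑ k ∈ Finset.range (N + 1), ∑ i,
        noiseMean I₀ v (fun t => ε t ω) n k i ^ 2 := fun ω => by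
    refine (sq_sum_le_card_mul_sum_sq (s := Finset.range (N + 1))).trans ?_
    rw [Finset.card_range, Nat.cast_add, Nat.cast_one, mul_assoc]
    refine mul_le_mul_of_nonneg_left ?_ (by positivity)
    rw [Finset.mul_sum]
    refine Finset.sum_le_sum fun k _ => ?_
    simpa using sq_sum_le_card_mul_sum_sq (s := (Finset.univ : Finset (Fin N)))
      (f := fun i => |noiseMean I₀ v (fun t => ε t ω) n k i|)
  have hint : ∀ k i, Integrable (fun ω => noiseMean I₀ v (fun t => ε t ω) n k i ^ 2) μ :=
    fun k i => (memLp_noiseMean hε_memLp I₀ v n k i).integrable_sq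
  refine (integral_mono (memLp_totalNoise hε_memLp I₀ v n).integrable_sq
    ((integrable_finsetSum _ fun k _ => integrable_finsetSum _ fun i _ => hint k i).const_mul _)
    hpt).trans (le_of_eq ?_)
  rw [integral_const_mul, integral_finsetSum _ fun k _ => integrable_finsetSum _ fun i _ => hint k i]
  have h1 : ∀ k ∈ Finset.range (N + 1),
      ∫ ω, ∑ i, noiseMean I₀ v (fun t => ε t ω) n k i ^ 2 ∂μ = N * (σ ^ 2 / batch I₀ v n) := by
    intro k _
    rw [integral_finsetSum _ fun i _ => hint k i]
    simp [integral_noiseMean_sq hε_indep hε_memLp hε_mean hε_var hI₀ hv]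
  rw [Finset.sum_congr rfl h1]
  simp only [Finset.sum_const, Finset.card_range, nsmul_eq_mul]
  push_cast; ring

/-- The shift `I ^ (-1/4)` balances the squared discretization error, of order `δ ^ 2`, and the
variance of the difference quotients, of order `1 / (I * δ ^ 2)`. -/
lemma integral_shift_add_noise_sq_le (hε_indep : iIndepFun ε μ)
    (hε_memLp : ∀ t i, MemLp (fun ω => ε t ω i) 2 μ) (hε_mean : ∀ t i, ∫ ω, ε t ω i ∂μ = 0)
    {σ : ℝ} (hε_var : ∀ t i, variance (fun ω => ε t ω i) μ = σ ^ 2)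
    {I₀ v : ℝ} (hI₀ : 1 ≤ I₀) (hv : 1 < v) (n : ℕ) :
    ∫ ω, (shift I₀ v n + totalNoise I₀ v (fun t => ε t ω) n / shift I₀ v n) ^ 2 ∂μ ≤
      (2 + 2 * (((N + 1) * N) ^ 2 * σ ^ 2)) * (√(batch I₀ v n : ℝ))⁻¹ := by
  have hδ := shift_pos hI₀ hv n
  have hI : (0 : ℝ) < batch I₀ v n := by exact_mod_cast batch_pos hI₀ hv n
  have hA := memLp_totalNoise hε_memLp I₀ v n
  have hAint := hA.integrable_sq
  have hXint := (memLp_shift_add_noise hε_memLp I₀ v n).integrable_sq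
  have hpt : ∀ ω, (shift I₀ v n + totalNoise I₀ v (fun t => ε t ω) n / shift I₀ v n) ^ 2 ≤
      2 * shift I₀ v n ^ 2 + 2 / shift I₀ v n ^ 2 * totalNoise I₀ v (fun t => ε t ω) n ^ 2 :=
    fun ω => by
      refine add_sq_le.trans (le_of_eq ?_)
      rw [div_pow]; ring
  refine (integral_mono hXint ((integrable_const _).add (hAint.const_mul _)) hpt).trans ?_
  rw [integral_add' (integrable_const _) (hAint.const_mul _)]
  simp only [integral_const, probReal_univ, one_smul, integral_const_mul]
  have h1 := integral_totalNoise_sq_le hε_indep hε_memLp hε_mean hε_var hI₀ hv n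
  have h2 := mul_le_mul_of_nonneg_left h1 (by positivity : 0 ≤ 2 / shift I₀ v n ^ 2)
  refine (add_le_add_right h2 _).trans (le_of_eq ?_)
  rw [shift_sq]
  have hs : 0 < √(batch I₀ v n : ℝ) := Real.sqrt_pos.2 hI
  have e : (batch I₀ v n : ℝ) = √(batch I₀ v n : ℝ) ^ 2 := (Real.sq_sqrt hI.le).symm
  set w := √(batch I₀ v n : ℝ)
  rw [e]
  field_simp

end Noise

/-! ### The recursion for the mean squared error -/

lemma le_mul_pow_of_le_mul_add {m : ℕ → ℝ} {a r B K : ℝ} (ha : 0 ≤ a) (hr : 0 ≤ r)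
    (h0 : m 0 ≤ K) (hK : B ≤ K * (r - a)) (h : ∀ n, m (n + 1) ≤ a * m n + B * r ^ n) (n : ℕ) :
    m n ≤ K * r ^ n := by
  induction n with
  | zero => simpa using h0
  | succ n ih =>
    have h1 := mul_le_mul_of_nonneg_left ih ha
    have h2 := mul_le_mul_of_nonneg_right hK (pow_nonneg hr n)
    rw [pow_succ]
    linarith [h n]

/-- Young's inequality with weights such that the factor of `x ^ 2` is `(1 + γ ^ 2) / 2`. -/
lemma mul_add_sq_le {γ : ℝ} (hγ0 : 0 ≤ γ) (hγ : γ < 1) (x w : ℝ) :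
    (γ * x + w) ^ 2 ≤ (1 + γ ^ 2) / 2 * x ^ 2 + (1 + γ ^ 2) / (1 - γ ^ 2) * w ^ 2 := by
  have h : 0 < 1 - γ ^ 2 := by nlinarith
  have e : (1 + γ ^ 2) / 2 * x ^ 2 + (1 + γ ^ 2) / (1 - γ ^ 2) * w ^ 2 - (γ * x + w) ^ 2
      = (1 - γ ^ 2) / 2 * (x - 2 * γ * w / (1 - γ ^ 2)) ^ 2 := by
    field_simp; ring
  have : 0 ≤ (1 - γ ^ 2) / 2 * (x - 2 * γ * w / (1 - γ ^ 2)) ^ 2 := by positivity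
  linarith

section MeanSquare

variable {N : ℕ} {M : Market N} {γ I₀ v : ℝ} {Ω : Type*} [MeasurableSpace Ω] {μ : Measure Ω}
  [IsProbabilityMeasure μ] {ε : ℕ → Ω → Fin N → ℝ} {phat : ℕ → Ω → Price N}
  {chat : ℕ → Ω → LinearCoeffs N}

lemma IsDDEP.integrable_norm_sq (h : IsDDEP M I₀ v ε phat chat) (p : Price N) (n : ℕ) :
    Integrable (fun ω => ‖phat n ω - p‖ ^ 2) μ := by
  obtain ⟨D, hD, hbox⟩ := M.exists_bound_box
  refine Integrable.of_bound (C := (D + ‖p‖) ^ 2)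
    (((h.measurable n).sub_const p).norm.pow_const 2).aestronglyMeasurable
    (Eventually.of_forall fun ω => ?_)
  rw [Real.norm_of_nonneg (by positivity)]
  have := (norm_sub_le (phat n ω) p).trans (add_le_add_left (hbox _ (h.mem_box n ω)) _)
  gcongr

/-- The mean squared distance to the equilibrium contracts up to an error that decreases like the
inverse square root of the batch sizes. -/
theorem exists_integral_norm_sq_le (hreg : M.Regular) (hdem : M.DemandAssumption)
    (hγ : γ < 1) (hz : M.ResponseAssumption γ) (hI₀ : 1 ≤ I₀) (hv : 1 < v)
    (hε_indep : iIndepFun ε μ) (hε_memLp : ∀ t i, MemLp (fun ω => ε t ω i) 2 μ)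
    (hε_mean : ∀ t i, ∫ ω, ε t ω i ∂μ = 0)
    {σ : ℝ} (hε_var : ∀ t i, variance (fun ω => ε t ω i) μ = σ ^ 2)
    {p : Price N} (hp : p ∈ M.box) (hfix : M.response p = p) :
    ∃ B > 0, ∀ phat chat, IsDDEP M I₀ v ε phat chat →
      ∫ ω, ‖phat 0 ω - p‖ ^ 2 ∂μ ≤ B ∧ ∀ n, ∫ ω, ‖phat (n + 1) ω - p‖ ^ 2 ∂μ ≤
        (1 + γ ^ 2) / 2 * ∫ ω, ‖phat n ω - p‖ ^ 2 ∂μ + B * ((√v)⁻¹) ^ n := by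
  obtain ⟨C, hC, hstep⟩ := IsDDEP.exists_norm_sub_response_le hreg hdem hz hI₀ hv ε
  obtain ⟨D, hD, hbox⟩ := M.exists_bound_box
  have hγ0 := hz.nonneg hreg
  have hγ2 : 0 < 1 - γ ^ 2 := by nlinarith
  set b := (1 + γ ^ 2) / (1 - γ ^ 2) with hb
  have hb0 : 0 < b := by positivity
  set B₁ := 2 + 2 * ((((N : ℝ) + 1) * N) ^ 2 * σ ^ 2) with hB₁
  have hB₁0 : 0 < B₁ := by positivity
  refine ⟨(2 * D) ^ 2 + b * C ^ 2 * B₁ * 2, by positivity, fun phat chat h => ⟨?_, fun n => ?_⟩⟩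
  · have h1 : ∀ ω, ‖phat 0 ω - p‖ ^ 2 ≤ (2 * D) ^ 2 := fun ω => by
      have : ‖phat 0 ω - p‖ ≤ 2 * D := by
        linarith [norm_sub_le (phat 0 ω) p, hbox _ (h.mem_box 0 ω), hbox _ hp]
      gcongr
    have h2 := integral_mono (h.integrable_norm_sq (μ := μ) p 0) (integrable_const _) h1
    simp only [integral_const, probReal_univ, one_smul] at h2
    have : 0 ≤ b * C ^ 2 * B₁ * 2 := by positivity
    linarith
  · set X : Ω → ℝ := fun ω => shift I₀ v n + totalNoise I₀ v (fun t => ε t ω) n / shift I₀ v n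
      with hX
    have hXint : Integrable (fun ω => X ω ^ 2) μ :=
      (memLp_shift_add_noise hε_memLp I₀ v n).integrable_sq
    have hpt : ∀ ω, ‖phat (n + 1) ω - p‖ ^ 2 ≤
        (1 + γ ^ 2) / 2 * ‖phat n ω - p‖ ^ 2 + b * C ^ 2 * X ω ^ 2 := fun ω => by
      have h1 : ‖phat (n + 1) ω - p‖ ≤ γ * ‖phat n ω - p‖ + C * X ω := by
        have h2 := Market.norm_response_sub_le hz (h.mem_box n ω) hp
        rw [hfix] at h2
        have h3 := norm_sub_le_norm_sub_add_norm_sub (phat (n + 1) ω) (M.response (phat n ω)) p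
        linarith [hstep phat chat h n ω]
      have h2 : ‖phat (n + 1) ω - p‖ ^ 2 ≤ (γ * ‖phat n ω - p‖ + C * X ω) ^ 2 := by gcongr
      refine h2.trans ((mul_add_sq_le hγ0 hγ _ _).trans (le_of_eq ?_))
      rw [mul_pow, mul_assoc]
    have hi1 := (h.integrable_norm_sq (μ := μ) p n).const_mul ((1 + γ ^ 2) / 2)
    have hi2 := hXint.const_mul (b * C ^ 2)
    have h1 := integral_mono (h.integrable_norm_sq (μ := μ) p (n + 1)) (hi1.add hi2) hpt
    rw [integral_add' hi1 hi2, integral_const_mul, integral_const_mul] at h1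
    have h2 := (integral_shift_add_noise_sq_le hε_indep hε_memLp hε_mean hε_var hI₀ hv n).trans
      (mul_le_mul_of_nonneg_left (inv_sqrt_batch_le hI₀ hv n) hB₁0.le)
    have h3 := mul_le_mul_of_nonneg_left h2 (by positivity : 0 ≤ b * C ^ 2)
    have hr : 0 ≤ ((√v)⁻¹) ^ n := by positivity
    have h4 : 0 ≤ (2 * D) ^ 2 * ((√v)⁻¹) ^ n := by positivity
    rw [add_mul]
    linarith

end MeanSquare

theorem theorem1 {N : ℕ} (M : Market N) (hreg : M.Regular) (hdem : M.DemandAssumption)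
    (γ : ℝ) (hγ : γ < 1) (hz : M.ResponseAssumption γ)
    (I₀ v : ℝ) (hI₀ : 1 ≤ I₀) (hv : 1 < v)
    {Ω : Type*} [MeasurableSpace Ω] (μ : Measure Ω) [IsProbabilityMeasure μ]
    (ε : ℕ → Ω → Fin N → ℝ) (hε_meas : ∀ t, Measurable (ε t))
    (hε_indep : iIndepFun ε μ) (hε_ident : ∀ s t, IdentDistrib (ε s) (ε t) μ μ)
    (hε_memLp : ∀ t i, MemLp (fun ω => ε t ω i) 2 μ)
    (hε_mean : ∀ t i, ∫ ω, ε t ω i ∂μ = 0)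
    (σ : ℝ) (hε_var : ∀ t i, variance (fun ω => ε t ω i) μ = σ ^ 2) :
    ∃ pstar : Price N,
      (∀ p, M.IsGNE p ↔ p = pstar) ∧
      (∀ p, M.IsClairvoyantKKT p ↔ p = pstar) ∧
      (∀ phat chat, IsDDEP M I₀ v ε phat chat →
        TendstoInMeasure μ phat atTop (fun _ => pstar)) ∧
      ((1 + γ ^ 2) / 2 * √v < 1 →
        ∃ K : ℝ, 0 < K ∧ ∀ phat chat, IsDDEP M I₀ v ε phat chat → ∀ n : ℕ,
          ∫ ω, ‖phat (n + 1) ω - pstar‖ ^ 2 ∂μ ≤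
            (N : ℝ) ^ 2 * K * (batch I₀ v n : ℝ) ^ (-(1 / 2) : ℝ)) := by
  obtain ⟨p, hp, hfix⟩ := Market.exists_response_eq hreg hz hγ
  have hKKT : ∀ q, M.IsClairvoyantKKT q ↔ q = p := fun q => by
    rw [Market.isClairvoyantKKT_iff_response hz]
    refine ⟨fun ⟨hq, hq'⟩ => Market.response_fixed_unique hz hγ hq hp hq' hfix, ?_⟩
    rintro rfl
    exact ⟨hp, hfix⟩
  have hγ0 := hz.nonneg hreg
  obtain ⟨B, hB, hrec⟩ := exists_integral_norm_sq_le (I₀ := I₀) (v := v) (μ := μ) (ε := ε)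
    hreg hdem hγ hz hI₀ hv hε_indep hε_memLp hε_mean hε_var hp hfix
  set a := (1 + γ ^ 2) / 2 with ha
  have ha0 : 0 ≤ a := by positivity
  have ha1 : a < 1 := by nlinarith
  have hsv : 1 < √v := Real.lt_sqrt_of_sq_lt (by simpa using hv)
  have hr0 : 0 < (√v)⁻¹ := by positivity
  have hr1 : (√v)⁻¹ < 1 := inv_lt_one_of_one_lt₀ hsv
  refine ⟨p, fun q => (Market.isGNE_iff_isClairvoyantKKT hreg hdem q).trans (hKKT q), hKKT,
    fun phat chat h => ?_, fun hav => ?_⟩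
  · obtain ⟨h0, hn⟩ := hrec phat chat h
    -- any rate above both `a` and `1 / √v` dominates the recursion
    obtain ⟨r, hrr, har, hr⟩ : ∃ r, (√v)⁻¹ ≤ r ∧ a < r ∧ r < 1 :=
      ⟨max (√v)⁻¹ ((a + 1) / 2), le_max_left _ _, lt_max_of_lt_right (by linarith),
        max_lt hr1 (by linarith)⟩
    have hK : B ≤ (B + B / (r - a)) * (r - a) := by
      have : 0 < r - a := by linarith
      rw [add_mul, div_mul_cancel₀ _ this.ne']
      nlinarith
    have hra : 0 < r - a := by linarith
    have hm := le_mul_pow_of_le_mul_add (m := fun n => ∫ ω, ‖phat n ω - p‖ ^ 2 ∂μ)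
      (K := B + B / (r - a)) ha0 (hr0.le.trans hrr)
      (h0.trans (le_add_of_nonneg_right (by positivity))) hK
      fun n => (hn n).trans (by gcongr)
    have hlim : Tendsto (fun n => ∫ ω, ‖phat n ω - p‖ ^ 2 ∂μ) atTop (𝓝 0) := by
      refine squeeze_zero (fun n => integral_nonneg fun ω => by positivity) hm ?_
      simpa using (tendsto_pow_atTop_nhds_zero_of_lt_one (hr0.le.trans hrr) hr).const_mul
        (B + B / (r - a))
    refine tendstoInMeasure_iff_measureReal_norm.2 fun η hη => ?_
    refine squeeze_zero (fun n => measureReal_nonneg) (fun n => ?_)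
      (by simpa using hlim.div_const (η ^ 2))
    have h1 := mul_meas_ge_le_integral_of_nonneg (μ := μ) (f := fun ω => ‖phat n ω - p‖ ^ 2)
      (Eventually.of_forall fun ω => by positivity) (h.integrable_norm_sq p n) (η ^ 2)
    rw [le_div_iff₀ (by positivity), mul_comm]
    refine le_trans (mul_le_mul_of_nonneg_left (measureReal_mono fun ω hω => ?_)
      (by positivity)) h1
    exact pow_le_pow_left₀ hη.le hω 2
  · have har : a < (√v)⁻¹ := by rwa [← one_div, lt_div_iff₀ (by positivity)]
    set r := (√v)⁻¹ with hr
    have hra : 0 < r - a := by linarith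
    set K := B + B / (r - a) with hKdef
    have hK0 : 0 < K := by positivity
    have hK : B ≤ K * (r - a) := by
      rw [hKdef, add_mul, div_mul_cancel₀ _ hra.ne']
      nlinarith
    refine ⟨K * √I₀, by positivity, fun phat chat h n => ?_⟩
    rcases Nat.eq_zero_or_pos N with rfl | hN
    · -- there is only one price vector
      simp [Subsingleton.elim (phat (n + 1) _) p]
    obtain ⟨h0, hn⟩ := hrec phat chat h
    have hm := le_mul_pow_of_le_mul_add (m := fun n => ∫ ω, ‖phat n ω - p‖ ^ 2 ∂μ) (K := K)
      ha0 hr0.le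
      (h0.trans (le_add_of_nonneg_right (by positivity))) hK hn (n + 1)
    have h1 : r ^ (n + 1) ≤ r ^ n := pow_le_pow_of_le_one hr0.le hr1.le (Nat.le_succ n)
    have h2 := inv_sqrt_pow_le hI₀ hv n
    have hN2 : (1 : ℝ) ≤ (N : ℝ) ^ 2 := one_le_pow₀ (by exact_mod_cast hN)
    rw [batch_rpow_eq]
    calc _ ≤ K * r ^ (n + 1) := hm
      _ ≤ K * (√I₀ * (√(batch I₀ v n : ℝ))⁻¹) := by gcongr; exact h1.trans h2
      _ = 1 * (K * √I₀ * (√(batch I₀ v n : ℝ))⁻¹) := by ring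
      _ ≤ (N : ℝ) ^ 2 * (K * √I₀ * (√(batch I₀ v n : ℝ))⁻¹) := by gcongr
      _ = _ := by ring
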